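/- Let $n\ge 1$, $\mathsf{s}=\operatorname{diag}(1,0,\dots,0)\in\mathfrak{gl}_n(\mathbb{C})$, and let $h:[n]\to[n]$ be a Hessenberg function, i.e. $h(i)\ge i$ for all $i$ and $h(1)\le\dots\le h(n)$. Put $h(0)=0$ and let $\mathcal{C}(h)=\{i\in[n]: h(i)>h(i-1)\}$ be the set of corners of $h$. Let $Z=(z_{ij})$ be the generic $n\times n$ matrix, with columns $v_1,\dots,v_n$, over $\mathbb{C}[\mathbf{z}]=\mathbb{C}[z_{ij}: i,j\in[n]]$, the coordinate ring of the affine scheme $M_n(\mathbb{C})$ of $n\times n$ matrices. Let $\mathcal{I}_{\mathsf{s},h}$ be the sum over $i\in[n]$ of the ideals generated by all minors of size $h(i)+1$ of the matrix $[\mathsf{s}v_1\cdots\mathsf{s}v_i\; v_1\cdots v_{h(i)}]$ (the zero ideal if $h(i)=n$). Let $\tilde{\mathcal{I}}_{\mathsf{s},h}$ be the preimage in $\mathbb{C}[\mathbf{z}]$ of the ideal generated by $\mathcal{I}_{\mathsf{s},h}$ in $\mathbb{C}[\mathbf{z},\det(Z)^{-1}]$. The matrix Hessenberg scheme is $\mathcal{Y}_{\mathsf{s},h}=\operatorname{Spec}(\mathbb{C}[\mathbf{z}]/\tilde{\mathcal{I}}_{\mathsf{s},h})$.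 For $0\le k\le n$ let $\mathcal{L}_k=\langle z_{11},\dots,z_{1k}\rangle$ (so $\mathcal{L}_0=0$), and for $1\le k\le n$ let $\mathcal{K}_k$ be the ideal generated by the $k\times k$ minors of $Z$ with rows $B\subseteq\{2,\dots,n\}$, $|B|=k$, and columns $1,\dots,k$ (so $\mathcal{K}_n=0$). Let $G=GL_n(\mathbb{C})$, let $B$ and $B_-$ be its subgroups of upper and of lower triangular matrices, and let $\pi:G\to G/B$ be the projection. For $w\in S_n$ let $\dot w$ be the permutation matrix with $\dot w e_j=e_{w(j)}$, let $\mathcal{X}_w=\overline{B\dot wB}$ and $\mathcal{X}^{\mathrm{op}}_w=\overline{B_-\dot wB}$ be the Zariski closures in $M_n(\mathbb{C})$, with their reduced structure, and let $X_w=\overline{B\dot wB/B}$ and $X^{\mathrm{op}}_w=\overline{B_-\dot wB/B}$ in $G/B$. If $X^{\mathrm{op}}_u\cap X_v\neq\emptyset$, the closure of $\pi^{-1}(X^{\mathrm{op}}_u\cap X_v)$ in $M_n(\mathbb{C})$, with its reduced structure, is called a matrix Richardson variety. Let $w_0$ be the longest element of $S_n$, $u[k]$ the shortest permutation with $u(k)=1$,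 and $v[k]$ the shortest permutation with $v(k)=n$. Then: (1) $\mathcal{Y}_{\mathsf{s},h}$ is reduced, and as closed subschemes of $M_n(\mathbb{C})$ (with scheme-theoretic unions and intersections) $$\mathcal{Y}_{\mathsf{s},h}=\bigcup_{i\in\mathcal{C}(h)}\left(\mathcal{X}^{\mathrm{op}}_{u[i]}\cap\mathcal{X}_{w_0v[h(i)]}\right).$$ For every $i\in\mathcal{C}(h)$ the variety $X^{\mathrm{op}}_{u[i]}\cap X_{w_0v[h(i)]}$ is nonempty, and $\mathcal{X}^{\mathrm{op}}_{u[i]}\cap\mathcal{X}_{w_0v[h(i)]}=\operatorname{Spec}\left(\mathbb{C}[\mathbf{z}]/(\mathcal{L}_{i-1}+\mathcal{K}_{h(i)})\right)$ is the corresponding matrix Richardson variety. (2) $\displaystyle \tilde{\mathcal{I}}_{\mathsf{s},h}=\mathcal{I}_{\mathsf{s},h}=\bigcap_{i\in\mathcal{C}(h)}\left(\mathcal{L}_{i-1}+\mathcal{K}_{h(i)}\right).$ (3) The ideals $\mathcal{L}_{i-1}+\mathcal{K}_{h(i)}$, $i\in\mathcal{C}(h)$, are prime and pairwise incomparable under inclusion,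 and they are exactly the associated primes of $\mathcal{I}_{\mathsf{s},h}$. Consequently $i\mapsto\mathcal{X}^{\mathrm{op}}_{u[i]}\cap\mathcal{X}_{w_0v[h(i)]}$ is a bijection from $\mathcal{C}(h)$ to the set of irreducible components of $\mathcal{Y}_{\mathsf{s},h}$. -/

import Mathlib

open AlgebraicGeometry CategoryTheory

namespace MatHess

/-! Conventions: `[n]` is modelled by `Fin n`, so the mathematical index `i ∈ {1, …, n}` is the
element of `Fin n` whose value is `i - 1`. -/

/-! ### Hessenberg functions and their corners -/

/-- `h : [n] → [n]` is a Hessenberg function: weakly increasing, and `h(i) ≥ i` for all `i`. -/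
def IsHessenberg {n : ℕ} (h : Fin n → Fin n) : Prop :=
  Monotone h ∧ ∀ i, i ≤ h i

/-- The set `C(h)` of corners: those `i` with `h(i) > h(i-1)`, where `h(0) = 0` (so that the first
index, which has no predecessor in `Fin n`, is always a corner). -/
def corners {n : ℕ} (h : Fin n → Fin n) : Set (Fin n) :=
  {i | ∀ j : Fin n, (j : ℕ) + 1 = i → h j < h i}

/-! ### The coordinate ring of `n × n` matrices and the ideals -/

/-- The polynomial ring `ℂ[z]` in the `n²` variables `z i j`. -/
abbrev CoordRing (n : ℕ) : Type := MvPolynomial (Fin n × Fin n) ℂ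

/-- The generic matrix `Z = (z i j)`. -/
noncomputable def genericZ (n : ℕ) : Matrix (Fin n) (Fin n) (CoordRing n) :=
  Matrix.mvPolynomialX (Fin n) (Fin n) ℂ

/-- The ideal generated by all `k × k` minors of a matrix `A`. Rows and columns are chosen by
injections, so every minor occurs, up to sign. It is zero if `A` has fewer than `k` rows. -/
def minorsIdeal {R m p : Type*} [CommRing R] (A : Matrix m p R) (k : ℕ) : Ideal R :=
  Ideal.span {f | ∃ (r : Fin k ↪ m) (c : Fin k ↪ p), f = (A.submatrix r c).det}

/-- The `n × (i + h(i))` matrix `[x v₁ ⋯ x vᵢ | v₁ ⋯ v_{h(i)}]`, where `v j` is the `j`-th column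
of `Z`. -/
noncomputable def hessMatrix {n : ℕ} (x : Matrix (Fin n) (Fin n) ℂ) (h : Fin n → Fin n)
    (i : Fin n) : Matrix (Fin n) ({j : Fin n // j ≤ i} ⊕ {j : Fin n // j ≤ h i}) (CoordRing n) :=
  Matrix.of fun a c => Sum.elim
    (fun j : {j : Fin n // j ≤ i} => (x.map (algebraMap ℂ (CoordRing n)) * genericZ n) a j)
    (fun j : {j : Fin n // j ≤ h i} => genericZ n a j) c

/-- The ideal expressing that the above matrix has rank at most `h(i)`: it is generated by its
minors of size `h(i) + 1`. (In terms of the value of `h i` in `Fin n` this size is `h i + 2`. If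
`h(i) = n` then there are no such minors and the ideal is zero.) -/
noncomputable def hessIdealAt {n : ℕ} (x : Matrix (Fin n) (Fin n) ℂ) (h : Fin n → Fin n)
    (i : Fin n) : Ideal (CoordRing n) :=
  minorsIdeal (hessMatrix x h i) ((h i : ℕ) + 2)

/-- The ideal `I_{x,h} = ∑ᵢ I_{x,h,i}`. -/
noncomputable def hessIdeal {n : ℕ} (x : Matrix (Fin n) (Fin n) ℂ) (h : Fin n → Fin n) :
    Ideal (CoordRing n) :=
  ⨆ i, hessIdealAt x h i

/-- The saturation `Ĩ` of an ideal `I` of `ℂ[z]`: the preimage in `ℂ[z]` of the ideal generated by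
the image of `I` in `ℂ[z, d⁻¹]`, where `d = det Z`. -/
noncomputable def saturate {n : ℕ} (I : Ideal (CoordRing n)) : Ideal (CoordRing n) :=
  (I.map (algebraMap (CoordRing n) (Localization.Away (genericZ n).det))).comap
    (algebraMap (CoordRing n) (Localization.Away (genericZ n).det))

/-- `L_k = ⟨z₁₁, …, z₁ₖ⟩`, generated by the first `k` variables of the first row. -/
noncomputable def idealL (n : ℕ) [NeZero n] (k : ℕ) : Ideal (CoordRing n) :=
  Ideal.span {f | ∃ j : Fin n, (j : ℕ) < k ∧ f = genericZ n 0 j}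

/-- `p_B`: for `B ⊆ [n]` with `|B| = k`, the minor of `Z` with rows `B` and columns `1, …, k`. -/
noncomputable def minorB {n k : ℕ} (B : Finset (Fin n)) (hB : B.card = k) : CoordRing n :=
  (Matrix.of fun a b : Fin k =>
    genericZ n (B.orderEmbOfFin hB a) (Fin.castLE (hB ▸ card_finset_fin_le B) b)).det

/-- `K_k = ⟨p_B | B ⊆ {2, …, n}, |B| = k⟩`. For `k = n` there is no such `B` and `K_n = 0`. -/
noncomputable def idealK (n : ℕ) [NeZero n] (k : ℕ) : Ideal (CoordRing n) :=
  Ideal.span {f | ∃ (B : Finset (Fin n)) (hB : B.card = k), 0 ∉ B ∧ f = minorB B hB}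

/-- The ideal `L_{i-1} + K_{h(i)}`. With `i` and `h i` in `Fin n`, the mathematical `i - 1` is the
value of `i`, and the mathematical `h(i)` is the value of `h i` plus one. -/
noncomputable def cornerIdeal {n : ℕ} [NeZero n] (h : Fin n → Fin n) (i : Fin n) :
    Ideal (CoordRing n) :=
  idealL n i ⊔ idealK n ((h i : ℕ) + 1)

/-- The matrix `s = diag(1, 0, …, 0)`. -/
def diagS (n : ℕ) [NeZero n] : Matrix (Fin n) (Fin n) ℂ :=
  Matrix.diagonal fun i => if i = 0 then 1 else 0

/-! ### Closed subschemes of the scheme of matrices -/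

/-- The affine scheme `M_n(ℂ) = Spec ℂ[z]`. -/
noncomputable abbrev MatScheme (n : ℕ) : Scheme.{0} := Spec (CommRingCat.of (CoordRing n))

/-- The affine scheme `Spec (ℂ[z] / I)`. -/
noncomputable abbrev subScheme {n : ℕ} (I : Ideal (CoordRing n)) : Scheme.{0} :=
  Spec (CommRingCat.of (CoordRing n ⧸ I))

/-- The closed immersion `Spec (ℂ[z] / I) ⟶ M_n(ℂ)`. -/
noncomputable def subSchemeι {n : ℕ} (I : Ideal (CoordRing n)) : subScheme I ⟶ MatScheme n :=
  Spec.map (CommRingCat.ofHom (Ideal.Quotient.mk I))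

/-- `Spec (ℂ[z] / I)` as a closed subscheme of `M_n(ℂ)`, given by its quasi-coherent ideal sheaf.
In the lattice of ideal sheaves `⊔` (the sum) is the scheme-theoretic intersection of closed
subschemes, and `⨅` (the intersection of ideal sheaves) is their scheme-theoretic union. -/
noncomputable def closedSub {n : ℕ} (I : Ideal (CoordRing n)) : (MatScheme n).IdealSheafData :=
  (subSchemeι I).ker

/-- The matrix Hessenberg scheme `Spec (ℂ[z] / Ĩ_{x,h})`. -/
noncomputable abbrev hessScheme {n : ℕ} (x : Matrix (Fin n) (Fin n) ℂ) (h : Fin n → Fin n) :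
    Scheme.{0} :=
  subScheme (saturate (hessIdeal x h))

/-! ### Permutations -/

/-- The inversions of a permutation. -/
def inversions {n : ℕ} (w : Equiv.Perm (Fin n)) : Finset (Fin n × Fin n) :=
  Finset.univ.filter fun p : Fin n × Fin n => p.1 < p.2 ∧ w p.2 < w p.1

/-- The length (number of inversions) of a permutation. -/
def permLength {n : ℕ} (w : Equiv.Perm (Fin n)) : ℕ :=
  (inversions w).card

/-- The longest element `w₀` of the symmetric group. -/
abbrev w0 (n : ℕ) : Equiv.Perm (Fin n) := Fin.revPerm

/-- `u[k]`: the shortest permutation with `u(k) = 1`. In one-line notation `1` is in position `k`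
and the remaining entries `2, …, n` increase. -/
def permU {n : ℕ} (k : Fin n) : Equiv.Perm (Fin n) := k.cycleRange

/-- `v[k]`: the shortest permutation with `v(k) = n`. In one-line notation `n` is in position `k`
and the remaining entries `1, …, n - 1` increase. -/
def permV {n : ℕ} (k : Fin n) : Equiv.Perm (Fin n) := w0 n * permU k.rev * w0 n

theorem inversions_permU {n : ℕ} (k : Fin n) :
    inversions (permU k) = Finset.univ.filter fun p : Fin n × Fin n => p.1 < p.2 ∧ p.2 = k := by
  have : NeZero n := ⟨by have := k.2; omega⟩
  ext ⟨a, b⟩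
  simp only [inversions, Finset.mem_filter, Finset.mem_univ, true_and]
  refine and_congr_right fun hab => ?_
  unfold permU
  rcases lt_trichotomy b k with hb | hb | hb
  · have h1 := Fin.coe_cycleRange_of_lt hb
    have h2 := Fin.coe_cycleRange_of_lt (hab.trans hb)
    simp only [Fin.lt_def, Fin.ext_iff] at *
    omega
  · subst hb
    have h2 := Fin.coe_cycleRange_of_lt hab
    simp only [Fin.cycleRange_self, Fin.lt_def, h2]
    simp
  · have h1 := Fin.cycleRange_of_gt hb
    have h2 := Fin.coe_cycleRange_of_le (i := a) (j := k)
    have h3 := Fin.cycleRange_of_gt (i := k) (j := a)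
    rcases le_or_gt a k with ha | ha
    · have h2 := h2 ha
      rw [h1]
      split_ifs at h2 <;> simp only [Fin.lt_def, Fin.ext_iff, Fin.le_def] at * <;> omega
    · rw [h1, h3 ha]
      simp only [Fin.lt_def, Fin.ext_iff] at *
      omega

/-- `u[k]` is the unique permutation of least length among those that send `k` to the first
index. -/
theorem permU_shortest {n : ℕ} [NeZero n] (k : Fin n) :
    permU k k = 0 ∧ ∀ w : Equiv.Perm (Fin n), w k = 0 →
      permLength (permU k) ≤ permLength w ∧ (permLength w = permLength (permU k) → w = permU k) := by
  have hk : permU k k = 0 := Fin.cycleRange_self k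
  refine ⟨hk, fun w hw => ?_⟩
  have hsub : inversions (permU k) ⊆ inversions w := by
    rw [inversions_permU]
    rintro ⟨a, b⟩ hab
    simp only [inversions, Finset.mem_filter, Finset.mem_univ, true_and] at hab ⊢
    obtain ⟨hab, rfl⟩ := hab
    refine ⟨hab, ?_⟩
    rw [hw]
    exact Fin.pos_iff_ne_zero.mpr fun h => hab.ne (w.injective (h.trans hw.symm))
  refine ⟨Finset.card_le_card hsub, fun hlen => ?_⟩
  have heq : inversions w = inversions (permU k) :=
    (Finset.eq_of_subset_of_card_le hsub hlen.le).symm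
  have hlt : ∀ a b, permU k a < permU k b → w a < w b := by
    intro a b hab
    have hne : a ≠ b := fun h => hab.ne (by rw [h])
    have hw' : w a ≠ w b := fun h => hne (w.injective h)
    rcases lt_or_gt_of_ne hne with h | h
    · by_contra hcon
      have : (a, b) ∈ inversions w := by
        simp only [inversions, Finset.mem_filter, Finset.mem_univ, true_and]
        exact ⟨h, lt_of_le_of_ne (not_lt.mp hcon) hw'.symm⟩
      rw [heq] at this
      simp only [inversions, Finset.mem_filter, Finset.mem_univ, true_and] at this
      exact absurd this.2 hab.asymm
    · have : (b, a) ∈ inversions (permU k) := by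
        simp only [inversions, Finset.mem_filter, Finset.mem_univ, true_and]
        exact ⟨h, hab⟩
      rw [← heq] at this
      simp only [inversions, Finset.mem_filter, Finset.mem_univ, true_and] at this
      exact this.2
  have hmono : StrictMono (fun x => w ((permU k).symm x)) := by
    intro x y hxy
    exact hlt _ _ (by simpa using hxy)
  have hid : ∀ x, w ((permU k).symm x) = x := by
    intro x
    have h1 : (OrderIso.refl (Fin n) : Fin n ≃o Fin n) =
        StrictMono.orderIsoOfSurjective _ hmono (((permU k).symm.trans w).surjective) :=
      Subsingleton.elim _ _
    have h2 := congrArg (fun e : Fin n ≃o Fin n => e x) h1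
    exact h2.symm
  ext a
  have := hid (permU k a)
  simp only [Equiv.symm_apply_apply] at this
  rw [this]

theorem length_conj_w0 {n : ℕ} (w : Equiv.Perm (Fin n)) : permLength (w0 n * w * w0 n) = permLength w := by
  unfold permLength inversions
  refine Finset.card_bij' (fun p _ => (p.2.rev, p.1.rev)) (fun p _ => (p.2.rev, p.1.rev))
    ?_ ?_ ?_ ?_ <;> simp +contextual [Fin.rev_lt_rev]

/-- `v[k]` is the unique permutation of least length among those that send `k` to the last
index. -/
theorem permV_shortest {n : ℕ} [NeZero n] (k : Fin n) :
    permV k k = Fin.rev 0 ∧ ∀ w : Equiv.Perm (Fin n), w k = Fin.rev 0 →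
      permLength (permV k) ≤ permLength w ∧ (permLength w = permLength (permV k) → w = permV k) := by
  obtain ⟨h1, h2⟩ := permU_shortest k.rev
  refine ⟨by simp [permV, h1], fun w hw => ?_⟩
  have hinv : w0 n * w0 n = 1 := by ext; simp
  obtain ⟨h3, h4⟩ := h2 (w0 n * w * w0 n) (by simp [hw])
  rw [length_conj_w0] at h3 h4
  rw [permV, length_conj_w0]
  refine ⟨h3, fun h => ?_⟩
  rw [← h4 h]
  calc w = (w0 n * w0 n) * w * (w0 n * w0 n) := by rw [hinv]; simp
    _ = _ := by simp only [mul_assoc]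

/-! ### Schubert varieties -/

/-- The permutation matrix `ẇ`, with `ẇ e_j = e_{w(j)}`. -/
def permMat {n : ℕ} (w : Equiv.Perm (Fin n)) : Matrix (Fin n) (Fin n) ℂ :=
  Matrix.of fun i j => if i = w j then 1 else 0

/-- The Borel subgroup `B` of upper triangular matrices in `GL_n(ℂ)`. -/
def borel (n : ℕ) : Subgroup (GL (Fin n) ℂ) where
  carrier := {g | Matrix.BlockTriangular (g : Matrix (Fin n) (Fin n) ℂ) id}
  one_mem' := by
    simpa using Matrix.blockTriangular_one
  mul_mem' := by
    intro a b ha hb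
    simpa using Matrix.BlockTriangular.mul ha hb
  inv_mem' := by
    intro a ha
    have : Invertible (a : Matrix (Fin n) (Fin n) ℂ) := a.invertible
    simpa [Matrix.coe_units_inv] using Matrix.blockTriangular_inv_of_blockTriangular ha

/-- The opposite Borel subgroup `B₋` of lower triangular matrices in `GL_n(ℂ)`. -/
def borelOp (n : ℕ) : Subgroup (GL (Fin n) ℂ) where
  carrier := {g | Matrix.BlockTriangular (g : Matrix (Fin n) (Fin n) ℂ) OrderDual.toDual}
  one_mem' := by
    simpa using Matrix.blockTriangular_one
  mul_mem' := by
    intro a b ha hb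
    simpa using Matrix.BlockTriangular.mul ha hb
  inv_mem' := by
    intro a ha
    have : Invertible (a : Matrix (Fin n) (Fin n) ℂ) := a.invertible
    simpa [Matrix.coe_units_inv] using Matrix.blockTriangular_inv_of_blockTriangular ha

/-- The subset `H ẇ B` of `GL_n(ℂ)`, for a subgroup `H`. -/
def doubleCoset {n : ℕ} (H : Subgroup (GL (Fin n) ℂ)) (w : Equiv.Perm (Fin n)) :
    Set (GL (Fin n) ℂ) :=
  {g | ∃ a ∈ H, ∃ b ∈ borel n,
    (g : Matrix (Fin n) (Fin n) ℂ) = (a : Matrix (Fin n) (Fin n) ℂ) * permMat w * b}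

/-- Evaluation of a polynomial function on matrices. -/
noncomputable def evalMat {n : ℕ} (M : Matrix (Fin n) (Fin n) ℂ) : CoordRing n →ₐ[ℂ] ℂ :=
  MvPolynomial.aeval fun p => M p.1 p.2

/-- The radical ideal of all polynomials that vanish on a set `S` of invertible matrices. Hence
`Spec (ℂ[z] / I(S))` is the Zariski closure of `S` in `M_n(ℂ)` with its reduced structure. -/
noncomputable def idealOfSet {n : ℕ} (S : Set (GL (Fin n) ℂ)) : Ideal (CoordRing n) :=
  ⨅ g : GL (Fin n) ℂ, ⨅ _ : g ∈ S, RingHom.ker (evalMat (g : Matrix (Fin n) (Fin n) ℂ))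

/-- The matrix Schubert variety `𝒳_w`, the closure of `B ẇ B` in `M_n(ℂ)`. -/
noncomputable def matSchubert {n : ℕ} (w : Equiv.Perm (Fin n)) : (MatScheme n).IdealSheafData :=
  closedSub (idealOfSet (doubleCoset (borel n) w))

/-- The opposite matrix Schubert variety `𝒳_w^op`, the closure of `B₋ ẇ B` in `M_n(ℂ)`. -/
noncomputable def matSchubertOp {n : ℕ} (w : Equiv.Perm (Fin n)) :
    (MatScheme n).IdealSheafData :=
  closedSub (idealOfSet (doubleCoset (borelOp n) w))

/-! ### Richardson varieties in the flag variety -/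

/-- The (points of the) flag variety `G / B`. -/
abbrev Flag (n : ℕ) : Type := GL (Fin n) ℂ ⧸ borel n

/-- The projection `π : G → G / B`. -/
def flagπ {n : ℕ} (g : GL (Fin n) ℂ) : Flag n := QuotientGroup.mk g

/-- Zariski closed subsets of `GL_n(ℂ)`: the common zeros in `GL_n(ℂ)` of a set of polynomials. -/
def IsZariskiClosed {n : ℕ} (T : Set (GL (Fin n) ℂ)) : Prop :=
  ∃ P : Set (CoordRing n),
    T = {g : GL (Fin n) ℂ | ∀ f ∈ P, evalMat (g : Matrix (Fin n) (Fin n) ℂ) f = 0}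

/-- The Zariski closure in `G / B`, whose closed sets are those with Zariski closed preimage
in `G`. -/
def flagClosure {n : ℕ} (S : Set (Flag n)) : Set (Flag n) :=
  ⋂₀ {F | S ⊆ F ∧ IsZariskiClosed (flagπ ⁻¹' F)}

/-- The Schubert variety `X_w ⊆ G / B`, the closure of `B ẇ B / B`. -/
def schubert {n : ℕ} (w : Equiv.Perm (Fin n)) : Set (Flag n) :=
  flagClosure (flagπ '' doubleCoset (borel n) w)

/-- The opposite Schubert variety `X_w^op ⊆ G / B`, the closure of `B₋ ẇ B / B`. -/
def schubertOp {n : ℕ} (w : Equiv.Perm (Fin n)) : Set (Flag n) :=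
  flagClosure (flagπ '' doubleCoset (borelOp n) w)

/-- The closure of `π⁻¹(X_u^op ∩ X_v)` in `M_n(ℂ)`, with its reduced structure. If
`X_u^op ∩ X_v` is nonempty, this is a matrix Richardson variety. -/
noncomputable def matRichardson {n : ℕ} (u v : Equiv.Perm (Fin n)) :
    (MatScheme n).IdealSheafData :=
  closedSub (idealOfSet (flagπ ⁻¹' (schubertOp u ∩ schubert v)))

end MatHess

open MatHess

/-! The ideals `L_{i-1} + K_{h(i)}` are understood through their zero loci. A matrix is a zero of
`L_{i-1} + K_{h(i)}` as soon as the first `i - 1` entries of its first row vanish and its first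
`h(i)` columns, without their entries in the first row, are linearly dependent. The heart of the
proof is that `L_{i-1} + K_{h(i)}` contains every polynomial vanishing on this locus
(`vanishingIdeal_dependentLocus`), and that the locus is irreducible
(`vanishingIdeal_dependentLocus_isPrime`).

The first fact is a case of the theorem that the maximal minors of a generic matrix generate a
prime ideal. It is proved by adding one row at a time, in the manner of Hochster and Eagon's
principal radical systems. The entries of the new row are killed one after the other. As long as at
least two entries of the row remain, the next one is a nonzerodivisor modulo the ideal of the locus,
by a deformation argument (`mem_vanishingIdeal_of_X_mul_mem`), and a graded Nakayama lemma
(`le_of_le_sup_span_X`) reduces the claim to the locus where it is killed as well. When one entry is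
left, the locus is a union of two loci with fewer rows or columns, and an expansion along the new
row (`X_mul_mem_maxMinors_sup`) finishes the induction. Irreducibility holds because matrices in
which one column is a combination of the others are dense in the locus, and any two of them are
joined by a polynomial curve in the locus.

Given this, the Schubert conditions follow by Gaussian elimination: a matrix `M` in the locus of
`L_{i-1}`, or in that of `K_k`, lies in the double coset of `w = u[i]`, or of `w = w₀ v[k]`, if the
leading principal minors of `ẇ⁻¹ M` do not vanish, and these minors are `1` at `M = ẇ`. Since the
ideals are prime, they are the ideals of the double cosets (`idealOfSet_doubleCoset_permU`,
`idealOfSet_doubleCoset_permV`). The Richardson variety is treated in the same way, with the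
determinant in place of the minors (`idealOfSet_richardson`).

For the Hessenberg ideal, `s v_j = z_{1j} e₁` gives that its `i`-th summand is `L_i K_{h(i)}`
(`hessIdealAt_diagS`). As the `L_k` and the `K_l` are generated in disjoint sets of variables, with
`L_k` increasing and `K_l` decreasing, the sum of these products is the intersection of the
`L_{i-1} + K_{h(i)}` by repeated use of the modular law (`hessIdeal_diagS`). The permutation matrix
of `u[q]` lies in the locus of the corner `i` exactly when `i ≤ q ≤ h(i)`. This separates the
corners, and with `q = i` it shows that none of the primes contains the determinant, whence the
saturation. The statements on associated primes and irreducible components are then general facts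
on irredundant intersections of primes. -/

namespace MatHess

/-! ### Polynomials along polynomial curves -/

section MaximalMinors

open MvPolynomial

variable {σ ι κ K : Type*} [Field K]

theorem eval_aeval_curve (P : σ → Polynomial K) (f : MvPolynomial σ K) (s : K) :
    (aeval P f).eval s = aeval (fun p => (P p).eval s) f := by
  have h := MvPolynomial.comp_aeval (R := K) P (Polynomial.aeval s)
  have h2 := congrArg (fun φ => φ f) h
  simpa [Polynomial.coe_aeval_eq_eval, Function.comp_def] using h2

/-- A polynomial in one variable that vanishes away from one point vanishes. -/
theorem eq_zero_of_eval_eq_zero_of_ne [Infinite K] (q : Polynomial K) (a : K)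
    (hq : ∀ s, s ≠ a → q.eval s = 0) : q = 0 := by
  refine Polynomial.eq_zero_of_infinite_isRoot q ?_
  exact (Set.infinite_univ.sdiff (Set.finite_singleton a)).mono fun s hs => hq s (by simpa using hs)

theorem aeval_curve_eq_zero [Infinite K] (P : σ → Polynomial K) (f : MvPolynomial σ K) (a : K)
    (hf : ∀ s, s ≠ a → aeval (fun p => (P p).eval s) f = 0) (s : K) :
    aeval (fun p => (P p).eval s) f = 0 := by
  have h := eq_zero_of_eval_eq_zero_of_ne (aeval P f) a fun t ht => by
    rw [eval_aeval_curve]; exact hf t ht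
  rw [← eval_aeval_curve, h, Polynomial.eval_zero]

/-! ### Homogeneous ideals and a graded Nakayama lemma -/

attribute [local instance] MvPolynomial.gradedAlgebra

theorem homogeneousComponent_succ_X_mul (p : σ) (h : MvPolynomial σ K) (d : ℕ) :
    homogeneousComponent (d + 1) (X p * h) = X p * homogeneousComponent d h := by
  classical
  ext m
  rw [coeff_homogeneousComponent, coeff_X_mul', coeff_X_mul', coeff_homogeneousComponent]
  by_cases hp : p ∈ m.support
  · have : m.degree = (m - Finsupp.single p 1).degree + 1 := by
      have h1 : Finsupp.single p 1 ≤ m := by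
        rw [Finsupp.single_le_iff]; have := Finsupp.mem_support_iff.mp hp; omega
      conv_lhs => rw [← tsub_add_cancel_of_le h1]
      rw [map_add, Finsupp.degree_single]
    simp [hp, this]
  · simp [hp]

theorem homogeneousComponent_zero_X_mul (p : σ) (h : MvPolynomial σ K) :
    homogeneousComponent 0 (X p * h) = 0 := by
  classical
  rw [homogeneousComponent_zero, coeff_X_mul']
  simp

/-- A form of the graded Nakayama lemma: `P ⊆ J + (y)` with `y` a variable that is a nonzerodivisor
modulo `P` gives `P ⊆ J + y P`, and hence `P ⊆ J` by induction on the degree. -/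
theorem le_of_le_sup_span_X {P J : Ideal (MvPolynomial σ K)} (p : σ)
    (hJ : J.IsHomogeneous (homogeneousSubmodule σ K)) (hJP : J ≤ P)
    (hreg : ∀ f, X p * f ∈ P → f ∈ P) (hle : P ≤ J ⊔ Ideal.span {X p}) : P ≤ J := by
  have key : ∀ d, ∀ f ∈ P, homogeneousComponent d f ∈ J := by
    intro d
    induction d with
    | zero =>
      intro f hf
      obtain ⟨g, hg, y, hy, rfl⟩ := Submodule.mem_sup.mp (hle hf)
      obtain ⟨h, rfl⟩ := Ideal.mem_span_singleton'.mp hy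
      rw [map_add, mul_comm h, homogeneousComponent_zero_X_mul, add_zero]
      exact homogeneousComponent_mem_of_mem hJ hg 0
    | succ d ih =>
      intro f hf
      obtain ⟨g, hg, y, hy, rfl⟩ := Submodule.mem_sup.mp (hle hf)
      obtain ⟨h, rfl⟩ := Ideal.mem_span_singleton'.mp hy
      have hh : h ∈ P := by
        refine hreg h ?_
        have := P.sub_mem hf (hJP hg)
        rwa [add_sub_cancel_left, mul_comm] at this
      rw [map_add, mul_comm h, homogeneousComponent_succ_X_mul]
      exact J.add_mem (homogeneousComponent_mem_of_mem hJ hg _) (J.mul_mem_left _ (ih h hh))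
  intro f hf
  rw [mem_iff_homogeneousComponent_mem hJ]
  exact fun d => key d f hf

/-! ### Ideals of maximal minors and their zero loci -/

/-- The ideal generated by the minors of the generic matrix `(X (a, b))` with rows in `A` and the
full list of columns `c`. Repeated rows are allowed, they contribute zero. -/
noncomputable def maxMinors (K : Type*) [Field K] {k : ℕ} (A : Finset ι) (c : Fin k ↪ κ) :
    Ideal (MvPolynomial (ι × κ) K) :=
  Ideal.span {f | ∃ r : Fin k → ι, (∀ j, r j ∈ A) ∧
    f = (Matrix.of fun a b : Fin k => (X (r a, c b) : MvPolynomial (ι × κ) K)).det}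

/-- The point `x`, a matrix, has zeros at the places `T`, and its rows in `A`, restricted to the
columns `c`, are orthogonal to `w`. -/
def IsKernelWitness {k : ℕ} (A : Finset ι) (c : Fin k ↪ κ) (T : Set (ι × κ)) (x : ι × κ → K)
    (w : Fin k → K) : Prop :=
  (∀ p ∈ T, x p = 0) ∧ ∀ a ∈ A, ∑ b, x (a, c b) * w b = 0

/-- The matrices with zeros at the places `T`, and for which the columns `c` of the submatrix with
rows `A` are linearly dependent. -/
def dependentLocus (K : Type*) [Field K] {k : ℕ} (A : Finset ι) (c : Fin k ↪ κ)
    (T : Set (ι × κ)) : Set (ι × κ → K) :=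
  {x | ∃ w : Fin k → K, w ≠ 0 ∧ IsKernelWitness A c T x w}

theorem maxMinors_isHomogeneous {k : ℕ} (A : Finset ι) (c : Fin k ↪ κ) :
    (maxMinors K A c).IsHomogeneous (homogeneousSubmodule (ι × κ) K) := by
  refine Ideal.homogeneous_span _ _ ?_
  rintro f ⟨r, -, rfl⟩
  refine ⟨k, ?_⟩
  rw [mem_homogeneousSubmodule, Matrix.det_apply]
  refine IsHomogeneous.sum _ _ _ fun τ _ => ?_
  have h : IsHomogeneous (∏ i : Fin k, (X (r (τ i), c i) : MvPolynomial (ι × κ) K)) k := by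
    simpa using IsHomogeneous.prod Finset.univ
      (fun i : Fin k => (X (r (τ i), c i) : MvPolynomial (ι × κ) K)) (fun _ => 1)
      (fun i _ => isHomogeneous_X _ _)
  rcases Int.units_eq_one_or (Equiv.Perm.sign τ) with hs | hs
  · simpa [hs] using h
  · simpa [hs, Units.smul_def] using h.neg

theorem span_X_isHomogeneous (T : Set σ) :
    (Ideal.span (X '' T : Set (MvPolynomial σ K))).IsHomogeneous (homogeneousSubmodule σ K) := by
  refine Ideal.homogeneous_span _ _ ?_
  rintro f ⟨p, -, rfl⟩
  exact ⟨1, isHomogeneous_X _ _⟩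

theorem maxMinors_mono {k : ℕ} {A B : Finset ι} (h : A ⊆ B) (c : Fin k ↪ κ) :
    maxMinors K A c ≤ maxMinors K B c := by
  refine Ideal.span_mono ?_
  rintro f ⟨r, hr, rfl⟩
  exact ⟨r, fun j => h (hr j), rfl⟩

/-- Minors with linearly dependent columns vanish. -/
theorem maxMinors_sup_le_vanishingIdeal {k : ℕ} (A : Finset ι) (c : Fin k ↪ κ)
    (T : Set (ι × κ)) :
    maxMinors K A c ⊔ Ideal.span (X '' T) ≤ vanishingIdeal K (dependentLocus K A c T) := by
  refine sup_le (Ideal.span_le.mpr ?_) (Ideal.span_le.mpr ?_)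
  · rintro f ⟨r, hr, rfl⟩ x ⟨w, hw, -, h⟩
    rw [AlgHom.map_det]
    refine Matrix.exists_mulVec_eq_zero_iff.mp ⟨w, hw, ?_⟩
    ext a
    simpa [Matrix.mulVec, dotProduct] using h _ (hr a)
  · rintro f ⟨p, hp, rfl⟩ x ⟨w, hw, h, -⟩
    simpa using h p hp

theorem maxMinors_fin_zero (A : Finset ι) (c : Fin 0 ↪ κ) : maxMinors K A c = ⊤ := by
  rw [Ideal.eq_top_iff_one]
  exact Ideal.subset_span ⟨Fin.elim0, fun j => j.elim0, by simp⟩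

/-- Deleting the last column: the maximal minors lie in the ideal of the maximal minors of the
remaining columns (expand along the last column). -/
theorem maxMinors_succ_le {k : ℕ} (A : Finset ι) (c : Fin (k + 1) ↪ κ) :
    maxMinors K A c ≤ maxMinors K A (Fin.castSuccEmb.trans c) := by
  refine Ideal.span_le.mpr ?_
  rintro f ⟨r, hr, rfl⟩
  rw [SetLike.mem_coe, Matrix.det_succ_column _ (Fin.last k)]
  refine Ideal.sum_mem _ fun i _ => Ideal.mul_mem_left _ _ ?_
  refine Ideal.subset_span ⟨fun j => r (i.succAbove j), fun j => hr _, ?_⟩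
  congr 1
  ext a b
  simp

variable [DecidableEq ι]

/-- A row with zeros outside the last column makes a maximal minor out of a minor of the remaining
columns. -/
theorem X_mul_mem_maxMinors_sup {k : ℕ} (A : Finset ι) (a₀ : ι) (c : Fin (k + 1) ↪ κ)
    (T : Set (ι × κ)) (hT : ∀ b : Fin k, (a₀, c b.castSucc) ∈ T) {f : MvPolynomial (ι × κ) K}
    (hf : f ∈ maxMinors K A (Fin.castSuccEmb.trans c)) :
    X (a₀, c (Fin.last k)) * f ∈ maxMinors K (insert a₀ A) c ⊔ Ideal.span (X '' T) := by
  refine Submodule.span_induction ?_ (by simp) ?_ ?_ hf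
  · rintro f ⟨r, hr, rfl⟩
    have h1 : (Matrix.of fun a b : Fin (k + 1) => (X ((Fin.snoc r a₀ : Fin (k + 1) → ι) a, c b) :
        MvPolynomial (ι × κ) K)).det ∈ maxMinors K (insert a₀ A) c := by
      refine Ideal.subset_span ⟨Fin.snoc r a₀, fun j => ?_, rfl⟩
      refine Fin.lastCases ?_ (fun j => ?_) j
      · simp
      · simp [hr j]
    rw [Matrix.det_succ_row _ (Fin.last k), Fin.sum_univ_castSucc] at h1
    have h2 : (∑ b : Fin k, (-1 : MvPolynomial (ι × κ) K) ^ ((Fin.last k : ℕ) + (b.castSucc : ℕ)) *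
        (Matrix.of fun a b : Fin (k + 1) => (X ((Fin.snoc r a₀ : Fin (k + 1) → ι) a, c b) :
          MvPolynomial (ι × κ) K)) (Fin.last k) b.castSucc *
        ((Matrix.of fun a b : Fin (k + 1) => (X ((Fin.snoc r a₀ : Fin (k + 1) → ι) a, c b) :
          MvPolynomial (ι × κ) K)).submatrix (Fin.last k).succAbove b.castSucc.succAbove).det) ∈
        Ideal.span (X '' T : Set (MvPolynomial (ι × κ) K)) := by
      refine Ideal.sum_mem _ fun b _ => Ideal.mul_mem_right _ _ (Ideal.mul_mem_left _ _ ?_)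
      refine Ideal.subset_span ⟨_, hT b, ?_⟩
      simp
    have h3 := Submodule.sub_mem _ (Ideal.mem_sup_left (T := Ideal.span (X '' T)) h1)
      (Ideal.mem_sup_right (S := maxMinors K (insert a₀ A) c) h2)
    rw [add_sub_cancel_left] at h3
    convert h3 using 1
    have h4 : ((-1 : MvPolynomial (ι × κ) K) ^ (k + k)) = 1 := by
      rw [← two_mul, pow_mul]; simp
    simp only [Fin.val_last, h4, one_mul, Matrix.of_apply, Fin.snoc_last]
    congr 2
    ext a b
    simp
  · intro f g _ _ hf hg
    rw [mul_add]
    exact Ideal.add_mem _ hf hg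
  · intro g f _ hf
    rw [smul_eq_mul, mul_left_comm]
    exact Ideal.mul_mem_left _ _ hf

variable [DecidableEq κ] [Infinite K]

/-- A matrix in the dependent locus with witness `w` is a limit of matrices in the locus with a
witness that has a nonzero coordinate `k₀`, if some column `τ` with `w τ ≠ 0` is free in the
rows `A`. -/
theorem aeval_eq_zero_of_witness {k : ℕ} {A : Finset ι} {c : Fin k ↪ κ} {T : Set (ι × κ)}
    {f : MvPolynomial (ι × κ) K} (k₀ τ : Fin k) (hτ : ∀ a ∈ A, (a, c τ) ∉ T)
    (hf : ∀ (x : ι × κ → K) (w : Fin k → K), IsKernelWitness A c T x w → w k₀ ≠ 0 → aeval x f = 0)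
    {x : ι × κ → K} {w : Fin k → K} (hx : IsKernelWitness A c T x w) (hw : w τ ≠ 0) :
    aeval x f = 0 := by
  by_cases hk : w k₀ = 0
  swap
  · exact hf x w hx hk
  have hne : k₀ ≠ τ := by rintro rfl; exact hw hk
  -- replace `w` by `w + s e_{k₀}` and correct the column `τ` accordingly
  let P : ι × κ → Polynomial K := fun p =>
    if p.1 ∈ A ∧ p.2 = c τ then
      Polynomial.C (x p) - Polynomial.C (x (p.1, c k₀) / w τ) * Polynomial.X
    else Polynomial.C (x p)
  have hP : ∀ s p, (P p).eval s =
      if p.1 ∈ A ∧ p.2 = c τ then x p - x (p.1, c k₀) / w τ * s else x p := by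
    intro s p
    simp only [P]
    split_ifs <;> simp
  have h0 : (fun p => (P p).eval 0) = x := by
    funext p
    rw [hP]
    simp
  rw [← h0]
  refine aeval_curve_eq_zero P f 0 (fun s hs => ?_) 0
  refine hf _ (w + Pi.single k₀ s) ⟨fun p hp => ?_, fun a ha => ?_⟩ ?_
  · simp only [hP]
    rw [if_neg, hx.1 p hp]
    rintro ⟨h1, h2⟩
    exact hτ p.1 h1 (by rw [← h2]; exact hp)
  · have h1 : ∀ b, (P (a, c b)).eval s =
        x (a, c b) - Pi.single (M := fun _ => K) τ (x (a, c k₀) / w τ * s) b := by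
      intro b
      rw [hP]
      by_cases hb : b = τ
      · subst hb; simp [ha]
      · simp [hb]
    simp only [h1, Pi.add_apply, sub_mul, mul_add, Finset.sum_sub_distrib, Finset.sum_add_distrib,
      hx.2 a ha]
    simp only [Pi.single_apply, mul_ite, mul_zero, ite_mul, zero_mul, Finset.sum_ite_eq',
      Finset.mem_univ, if_true]
    field_simp
    simp [hne]
  · simpa [hk] using hs

/-- The ideal of a coordinate subspace is generated by variables. -/
theorem vanishingIdeal_coordinateSubspace (T : Set σ) :
    vanishingIdeal K {x : σ → K | ∀ p ∈ T, x p = 0} ≤ Ideal.span (X '' T) := by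
  classical
  intro f hf
  let ψ : MvPolynomial σ K →ₐ[K] MvPolynomial σ K := aeval fun p => if p ∈ T then 0 else X p
  have h1 : ψ f = 0 := by
    apply MvPolynomial.funext
    intro x
    have h2 := hf (fun p => if p ∈ T then 0 else x p) (fun p hp => by simp [hp])
    have h3 := MvPolynomial.comp_aeval (R := K)
      (fun p => if p ∈ T then 0 else (X p : MvPolynomial σ K)) (aeval x)
    have h4 := congrArg (fun φ => φ f) h3
    simp only [AlgHom.comp_apply] at h4
    rw [map_zero, ← MvPolynomial.coe_aeval_eq_eval, RingHom.coe_coe, h4, ← h2]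
    congr 2
    funext p
    split_ifs <;> simp
  have h2 : ∀ g, Ideal.Quotient.mk (Ideal.span (X '' T : Set (MvPolynomial σ K))) (ψ g) =
      Ideal.Quotient.mk _ g := by
    intro g
    have : ((Ideal.Quotient.mkₐ K (Ideal.span (X '' T : Set (MvPolynomial σ K)))).comp ψ) =
        Ideal.Quotient.mkₐ K _ := by
      ext p
      simp only [ψ, AlgHom.comp_apply, aeval_X]
      split_ifs with hp
      · rw [map_zero, eq_comm]
        exact Ideal.Quotient.eq_zero_iff_mem.mpr (Ideal.subset_span ⟨p, hp, rfl⟩)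
      · rfl
    exact congrArg (fun φ => φ g) this
  rw [← Ideal.Quotient.eq_zero_iff_mem, ← h2, h1, map_zero]


/-- An entry of the row `a₀` outside the last column is a nonzerodivisor modulo the ideal of the
dependent locus, provided that its column is free in all the rows and that the last entry of the
row `a₀` is free. -/
theorem mem_vanishingIdeal_of_X_mul_mem {k : ℕ} {A : Finset ι} {a₀ : ι} (ha₀ : a₀ ∉ A)
    {c : Fin (k + 1) ↪ κ} {T : Set (ι × κ)} (t : Fin (k + 1)) (ht : t ≠ Fin.last k)
    (hT : ∀ a ∈ insert a₀ A, (a, c t) ∉ T) (hT' : (a₀, c (Fin.last k)) ∉ T)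
    {f : MvPolynomial (ι × κ) K}
    (hf : X (a₀, c t) * f ∈ vanishingIdeal K (dependentLocus K (insert a₀ A) c T)) :
    f ∈ vanishingIdeal K (dependentLocus K (insert a₀ A) c T) := by
  -- the row `a₀` can be moved inside the hyperplane orthogonal to the witness, along
  -- `e_t - (w_t / w_k) e_k`; if `w_t = 0` this is `e_t`, also for `w_k = 0`
  have key : ∀ (x : ι × κ → K) (w : Fin (k + 1) → K), w ≠ 0 →
      IsKernelWitness (insert a₀ A) c T x w → (w t = 0 ∨ w (Fin.last k) ≠ 0) →
      aeval x f = 0 := by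
    intro x w hw hx htl
    let P : ι × κ → Polynomial K := fun p =>
      if p = (a₀, c t) then Polynomial.C (x p) + Polynomial.X
      else if p = (a₀, c (Fin.last k)) then
        Polynomial.C (x p) - Polynomial.C (w t / w (Fin.last k)) * Polynomial.X
      else Polynomial.C (x p)
    have hP : ∀ s p, (P p).eval s =
        if p = (a₀, c t) then x p + s
        else if p = (a₀, c (Fin.last k)) then x p - w t / w (Fin.last k) * s else x p := by
      intro s p
      simp only [P]
      split_ifs <;> simp
    have h0 : (fun p => (P p).eval 0) = x := by
      funext p
      rw [hP]
      simp
    rw [← h0]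
    refine aeval_curve_eq_zero P f (-x (a₀, c t)) (fun s hs => ?_) 0
    have h1 := hf (fun p => (P p).eval s) ⟨w, hw, fun p hp => ?_, fun a ha => ?_⟩
    · rw [map_mul, aeval_X] at h1
      refine (mul_eq_zero.mp h1).resolve_left ?_
      rw [hP, if_pos rfl]
      intro h2
      exact hs (by linear_combination h2)
    · simp only [hP]
      rw [if_neg, if_neg, hx.1 p hp]
      · rintro rfl; exact hT' hp
      · rintro rfl; exact hT _ (Finset.mem_insert_self _ _) hp
    · by_cases haa : a = a₀
      · subst haa
        have h1 : ∀ b, (P (a, c b)).eval s * w b =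
            x (a, c b) * w b + ((if b = t then s * w t else 0) -
              (if b = Fin.last k then w t / w (Fin.last k) * s * w (Fin.last k) else 0)) := by
          intro b
          simp only [hP, Prod.mk.injEq, true_and, c.injective.eq_iff]
          by_cases hb : b = t
          · subst hb
            simp [ht]
            ring
          · by_cases hb' : b = Fin.last k
            · subst hb'
              simp [hb]
              ring
            · simp [hb, hb']
        simp only [h1, Finset.sum_add_distrib, Finset.sum_sub_distrib, hx.2 a ha,
          Finset.sum_ite_eq', Finset.mem_univ, if_true]
        rcases htl with h | h
        · simp [h]
        · field_simp
          simp
      · have h1 : ∀ b, (P (a, c b)).eval s = x (a, c b) := fun b => by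
          simp [hP, haa]
        simp only [h1]
        exact hx.2 a ha
  rintro x ⟨w, hw, hx⟩
  by_cases htl : w t = 0 ∨ w (Fin.last k) ≠ 0
  · exact key x w hw hx htl
  · push Not at htl
    refine aeval_eq_zero_of_witness (Fin.last k) t hT (fun x' w' hx' hw' => ?_) hx htl.1
    exact key x' w' (fun h => hw' (by simp [h])) hx' (Or.inr hw')

/-- The entries outside of the rows `A` and the places `T` are free on the dependent locus. -/
theorem mem_vanishingIdeal_of_X_mul_mem_of_notMem {k : ℕ} {A : Finset ι} {c : Fin k ↪ κ}
    {T : Set (ι × κ)} {q : ι × κ} (hA : q.1 ∉ A) (hq : q ∉ T) {f : MvPolynomial (ι × κ) K}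
    (hf : X q * f ∈ vanishingIdeal K (dependentLocus K A c T)) :
    f ∈ vanishingIdeal K (dependentLocus K A c T) := by
  rintro x ⟨w, hw, hx⟩
  let P : ι × κ → Polynomial K := fun p => if p = q then Polynomial.X else Polynomial.C (x p)
  have hP : ∀ s p, (P p).eval s = if p = q then s else x p := by
    intro s p
    simp only [P]
    split_ifs <;> simp
  have h0 : (fun p => (P p).eval (x q)) = x := by
    funext p
    rw [hP]
    split_ifs with h
    · rw [h]
    · rfl
  rw [← h0]
  refine aeval_curve_eq_zero P f 0 (fun s hs => ?_) (x q)
  have h1 := hf (fun p => (P p).eval s) ⟨w, hw, fun p hp => ?_, fun a ha => ?_⟩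
  · rw [map_mul, aeval_X, hP, if_pos rfl] at h1
    exact (mul_eq_zero.mp h1).resolve_left hs
  · simp only [hP]
    rw [if_neg, hx.1 p hp]
    rintro rfl
    exact hq hp
  · rw [← hx.2 a ha]
    refine Finset.sum_congr rfl fun b _ => ?_
    simp only [hP]
    rw [if_neg]
    rintro rfl
    exact hA ha

/-- The maximal minors of a generic matrix generate the ideal of all polynomials that vanish on
the matrices with linearly dependent columns. More generally this holds after killing variables
in other rows. -/
theorem vanishingIdeal_dependentLocus_le (A : Finset ι) : ∀ {k : ℕ} (c : Fin k ↪ κ)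
    (T : Set (ι × κ)), (∀ a ∈ A, ∀ q, (a, q) ∉ T) →
    vanishingIdeal K (dependentLocus K A c T) ≤ maxMinors K A c ⊔ Ideal.span (X '' T) := by
  induction A using Finset.induction_on with
  | empty =>
    intro k c T _
    cases k with
    | zero => simp [maxMinors_fin_zero]
    | succ k =>
      refine le_trans (vanishingIdeal_anti_mono ?_)
        ((vanishingIdeal_coordinateSubspace T).trans le_sup_right)
      intro x hx
      refine ⟨Pi.single 0 1, fun h => ?_, hx, fun a ha => by simp at ha⟩
      simpa using congrFun h 0
  | insert a₀ A ha₀ ih =>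
    intro k c T hT
    cases k with
    | zero => simp [maxMinors_fin_zero]
    | succ k =>
      -- kill the first `t` entries of the row `a₀` in the columns `c`
      let S : ℕ → Set (ι × κ) := fun t => T ∪ {p | ∃ b : Fin (k + 1), (b : ℕ) < t ∧ p = (a₀, c b)}
      have hS_ne : ∀ t, ∀ a ∈ A, ∀ q, (a, q) ∉ S t := by
        rintro t a ha q (h | ⟨b, -, h⟩)
        · exact hT a (Finset.mem_insert_of_mem ha) q h
        · rw [Prod.mk.injEq] at h
          exact ha₀ (h.1 ▸ ha)
      have hS_mem : ∀ t (b : Fin (k + 1)), (a₀, c b) ∈ S t ↔ (b : ℕ) < t := by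
        intro t b
        constructor
        · rintro (h | ⟨b', hb', h⟩)
          · exact absurd h (hT a₀ (Finset.mem_insert_self _ _) _)
          · rw [Prod.mk.injEq, c.injective.eq_iff] at h
            rw [h.2]; exact hb'
        · exact fun h => Or.inr ⟨b, h, rfl⟩
      have hS_succ : ∀ t (ht : t < k + 1), S (t + 1) = insert (a₀, c ⟨t, ht⟩) (S t) := by
        intro t ht
        ext p
        simp only [S, Set.mem_union, Set.mem_insert_iff, Set.mem_ofPred_eq]
        constructor
        · rintro (h | ⟨b, hb, rfl⟩)
          · exact Or.inr (Or.inl h)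
          · rcases Nat.lt_succ_iff_lt_or_eq.mp hb with hb | hb
            · exact Or.inr (Or.inr ⟨b, hb, rfl⟩)
            · left
              congr
              exact Fin.ext hb
        · rintro (rfl | h | ⟨b, hb, rfl⟩)
          · exact Or.inr ⟨_, Nat.lt_succ_self t, rfl⟩
          · exact Or.inl h
          · exact Or.inr ⟨b, hb.trans (Nat.lt_succ_self t), rfl⟩
      have hspan : ∀ t (ht : t < k + 1), Ideal.span (X '' S (t + 1)) =
          Ideal.span (X '' S t) ⊔ Ideal.span {(X (a₀, c ⟨t, ht⟩) : MvPolynomial (ι × κ) K)} := by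
        intro t ht
        rw [hS_succ t ht, Set.image_insert_eq, Ideal.span_insert, sup_comm]
      suffices H : ∀ d t, t + d = k →
          vanishingIdeal K (dependentLocus K (insert a₀ A) c (S t)) ≤
            maxMinors K (insert a₀ A) c ⊔ Ideal.span (X '' S t) by
        have h := H k 0 (zero_add k)
        have h0 : S 0 = T := by simp [S]
        rwa [h0] at h
      intro d
      induction d with
      | zero =>
        intro t ht
        obtain rfl : t = k := by simpa using ht
        intro f hf
        set c' := Fin.castSuccEmb.trans c with hc'
        -- two components: the last entry of the row `a₀` vanishes, or the other columns are
        -- dependent in the rows `A`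
        have h1 : f ∈ vanishingIdeal K (dependentLocus K A c (S (t + 1))) := by
          refine vanishingIdeal_anti_mono ?_ hf
          rintro x ⟨w, hw, hx1, hx2⟩
          refine ⟨w, hw, fun p hp => hx1 p ?_, fun a ha => ?_⟩
          · rw [hS_succ t (Nat.lt_succ_self t)]
            exact Or.inr hp
          · rcases Finset.mem_insert.mp ha with rfl | ha
            · refine Finset.sum_eq_zero fun b _ => ?_
              rw [hx1 _ ((hS_mem _ b).mpr b.2), zero_mul]
            · exact hx2 a ha
        have hlocus : dependentLocus K A c' (S t) ⊆ dependentLocus K (insert a₀ A) c (S t) := by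
          rintro x ⟨w, hw, hx1, hx2⟩
          refine ⟨Fin.snoc w 0, fun h => hw ?_, hx1, fun a ha => ?_⟩
          · funext b
            simpa using congrFun h b.castSucc
          · rw [Fin.sum_univ_castSucc]
            simp only [Fin.snoc_castSucc, Fin.snoc_last, mul_zero, add_zero]
            rcases Finset.mem_insert.mp ha with rfl | ha
            · refine Finset.sum_eq_zero fun b _ => ?_
              rw [hx1 _ ((hS_mem _ b.castSucc).mpr (by simp)), zero_mul]
            · exact hx2 a ha
        have h2 : f ∈ vanishingIdeal K (dependentLocus K A c' (S t)) :=
          vanishingIdeal_anti_mono hlocus hf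
        have h3 := ih c (S (t + 1)) (hS_ne _) h1
        rw [hspan t (Nat.lt_succ_self t), ← sup_assoc] at h3
        obtain ⟨g, hg, y, hy, rfl⟩ := Submodule.mem_sup.mp h3
        obtain ⟨h, rfl⟩ := Ideal.mem_span_singleton'.mp hy
        have hg' : g ∈ vanishingIdeal K (dependentLocus K A c' (S t)) :=
          maxMinors_sup_le_vanishingIdeal A c' (S t)
            (sup_le_sup_right (maxMinors_succ_le A c) _ hg)
        have h4 : h ∈ vanishingIdeal K (dependentLocus K A c' (S t)) := by
          refine mem_vanishingIdeal_of_X_mul_mem_of_notMem (q := (a₀, c (Fin.last t))) ha₀ ?_ ?_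
          · rw [hS_mem]
            simp
          · have := Ideal.sub_mem _ h2 hg'
            rwa [add_sub_cancel_left, mul_comm] at this
        obtain ⟨m, hm, l, hl, rfl⟩ := Submodule.mem_sup.mp (ih c' (S t) (hS_ne _) h4)
        refine Ideal.add_mem _
          (sup_le_sup_right (maxMinors_mono (Finset.subset_insert a₀ A) c) _ hg) ?_
        rw [add_mul]
        refine Ideal.add_mem _ ?_ (Ideal.mem_sup_right (Ideal.mul_mem_right _ _ hl))
        rw [mul_comm]
        exact X_mul_mem_maxMinors_sup A a₀ c (S t)
          (fun b => (hS_mem _ _).mpr (by simp)) hm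
      | succ d ihd =>
        intro t ht
        have htk : t < k + 1 := by omega
        refine le_of_le_sup_span_X (a₀, c ⟨t, htk⟩)
          ((maxMinors_isHomogeneous _ c).sup (span_X_isHomogeneous _))
          (maxMinors_sup_le_vanishingIdeal _ _ _) (fun f hf => ?_) ?_
        · refine mem_vanishingIdeal_of_X_mul_mem ha₀ ⟨t, htk⟩ ?_ (fun a ha => ?_) ?_ hf
          · rw [Ne, Fin.ext_iff, Fin.val_last]
            simp only
            omega
          · rcases Finset.mem_insert.mp ha with rfl | ha
            · rw [hS_mem]
              simp
            · exact hS_ne _ _ ha _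
          · rw [hS_mem, Fin.val_last]
            omega
        · rw [sup_assoc, ← hspan t htk]
          refine le_trans (vanishingIdeal_anti_mono ?_) (ihd (t + 1) (by omega))
          rintro x ⟨w, hw, hx1, hx2⟩
          refine ⟨w, hw, fun p hp => hx1 p ?_, hx2⟩
          rw [hS_succ t htk]
          exact Or.inr hp

theorem vanishingIdeal_dependentLocus {A : Finset ι} {k : ℕ} (c : Fin k ↪ κ) {T : Set (ι × κ)}
    (hT : ∀ a ∈ A, ∀ q, (a, q) ∉ T) :
    vanishingIdeal K (dependentLocus K A c T) = maxMinors K A c ⊔ Ideal.span (X '' T) :=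
  le_antisymm (vanishingIdeal_dependentLocus_le A c T hT) (maxMinors_sup_le_vanishingIdeal A c T)

/-- A polynomial that does not vanish on the dependent locus does not vanish at some point with a
witness whose last coordinate is one. -/
theorem exists_witness_of_notMem_vanishingIdeal {A : Finset ι} {k : ℕ} {c : Fin (k + 1) ↪ κ}
    {T : Set (ι × κ)} (hT : ∀ a ∈ A, ∀ q, (a, q) ∉ T) {f : MvPolynomial (ι × κ) K}
    (hf : f ∉ vanishingIdeal K (dependentLocus K A c T)) :
    ∃ (x : ι × κ → K) (w : Fin (k + 1) → K), IsKernelWitness A c T x w ∧ w (Fin.last k) = 1 ∧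
      aeval x f ≠ 0 := by
  by_contra! hcon
  refine hf ?_
  rintro x ⟨w, hw, hx⟩
  obtain ⟨τ, hτ⟩ := Function.ne_iff.mp hw
  refine aeval_eq_zero_of_witness (Fin.last k) τ (fun a ha => hT a ha _) (fun x' w' hx' hw' => ?_)
    hx hτ
  refine hcon x' ((w' (Fin.last k))⁻¹ • w') ⟨hx'.1, fun a ha => ?_⟩ ?_
  · simp only [Pi.smul_apply, smul_eq_mul, mul_left_comm]
    rw [← Finset.mul_sum, hx'.2 a ha, mul_zero]
  · simp [hw']

/-- The dependent locus is irreducible: matrices whose last column `c` is, in the rows `A`, a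
combination of the other columns are dense, and any two of these are joined by the polynomial
curve that interpolates linearly the other columns and the coefficients. -/
theorem vanishingIdeal_dependentLocus_isPrime {A : Finset ι} {k : ℕ} (c : Fin (k + 1) ↪ κ)
    {T : Set (ι × κ)} (hT : ∀ a ∈ A, ∀ q, (a, q) ∉ T) :
    (vanishingIdeal K (dependentLocus K A c T)).IsPrime := by
  rw [Ideal.isPrime_iff]
  constructor
  · rw [Ne, Ideal.eq_top_iff_one]
    intro h
    have h1 := h 0 ⟨Pi.single 0 1, fun h => by simpa using congrFun h 0, fun p _ => rfl,
      fun a _ => by simp⟩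
    simp at h1
  intro f g hfg
  by_contra! hcon
  obtain ⟨x₁, w₁, hx₁, hw₁, hf⟩ := exists_witness_of_notMem_vanishingIdeal hT hcon.1
  obtain ⟨x₂, w₂, hx₂, hw₂, hg⟩ := exists_witness_of_notMem_vanishingIdeal hT hcon.2
  let y : ι × κ → Polynomial K := fun p =>
    Polynomial.C (x₁ p) * (1 - Polynomial.X) + Polynomial.C (x₂ p) * Polynomial.X
  let u : Fin (k + 1) → Polynomial K := fun b =>
    Polynomial.C (w₁ b) * (1 - Polynomial.X) + Polynomial.C (w₂ b) * Polynomial.X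
  let P : ι × κ → Polynomial K := fun p =>
    if p.1 ∈ A ∧ p.2 = c (Fin.last k) then -∑ b : Fin k, y (p.1, c b.castSucc) * u b.castSucc
    else y p
  have hlast : ∀ (x : ι × κ → K) (w : Fin (k + 1) → K), IsKernelWitness A c T x w →
      w (Fin.last k) = 1 → ∀ a ∈ A,
      -∑ b : Fin k, x (a, c b.castSucc) * w b.castSucc = x (a, c (Fin.last k)) := by
    intro x w hx hw a ha
    have := hx.2 a ha
    rw [Fin.sum_univ_castSucc, hw] at this
    linear_combination -this
  have hP0 : (fun p => (P p).eval 0) = x₁ := by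
    funext p
    simp only [P]
    split_ifs with h
    · have := hlast x₁ w₁ hx₁ hw₁ p.1 h.1
      rw [← h.2] at this
      simpa [Polynomial.eval_finsetSum, y, u] using this
    · simp [y]
  have hP1 : (fun p => (P p).eval 1) = x₂ := by
    funext p
    simp only [P]
    split_ifs with h
    · have := hlast x₂ w₂ hx₂ hw₂ p.1 h.1
      rw [← h.2] at this
      simpa [Polynomial.eval_finsetSum, y, u] using this
    · simp [y]
  have hmul : aeval P f * aeval P g = 0 := by
    rw [← map_mul]
    refine eq_zero_of_eval_eq_zero_of_ne _ 0 fun s _ => ?_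
    rw [eval_aeval_curve]
    have hu : (u (Fin.last k)).eval s = 1 := by simp [u, hw₁, hw₂]
    refine hfg _ ⟨fun b => (u b).eval s, fun h => ?_, fun p hp => ?_, fun a ha => ?_⟩
    · have := congrFun h (Fin.last k)
      simp [hu] at this
    · have : ¬ (p.1 ∈ A ∧ p.2 = c (Fin.last k)) := fun h => hT p.1 h.1 p.2 hp
      simp [P, this, y, hx₁.1 p hp, hx₂.1 p hp]
    · beta_reduce
      rw [Fin.sum_univ_castSucc, hu, mul_one]
      have h1 : ∀ b : Fin k, P (a, c b.castSucc) = y (a, c b.castSucc) := fun b => by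
        simp only [P]
        rw [if_neg]
        rintro ⟨-, h⟩
        exact b.castSucc_lt_last.ne (c.injective h)
      have h2 : P (a, c (Fin.last k)) = -∑ b : Fin k, y (a, c b.castSucc) * u b.castSucc := by
        simp [P, ha]
      simp only [h1, h2, Polynomial.eval_neg, Polynomial.eval_finsetSum, Polynomial.eval_mul]
      ring
  rcases mul_eq_zero.mp hmul with h | h
  · apply hf
    rw [← hP0, ← eval_aeval_curve, h, Polynomial.eval_zero]
  · apply hg
    rw [← hP1, ← eval_aeval_curve, h, Polynomial.eval_zero]

end MaximalMinors

/-! ### The ideals of first-row variables and of minors of the other rows -/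

section CornerIdeals

open MvPolynomial

theorem genericZ_apply {m : ℕ} (i j : Fin m) : genericZ m i j = X (i, j) :=
  rfl

variable {n : ℕ}

/-- The minor of the generic matrix with rows `w(1), …, w(m)` and columns `1, …, m`: the
`m`-th leading principal minor of `ẇ⁻¹ Z`. -/
noncomputable def leadingMinor (w : Equiv.Perm (Fin n)) {m : ℕ} (hm : m ≤ n) : CoordRing n :=
  (Matrix.of fun a b : Fin m =>
    (X (w (Fin.castLE hm a), Fin.castLE hm b) : CoordRing n)).det

theorem evalMat_leadingMinor (w : Equiv.Perm (Fin n)) {m : ℕ} (hm : m ≤ n)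
    (M : Matrix (Fin n) (Fin n) ℂ) : evalMat M (leadingMinor w hm) =
      (Matrix.of fun a b : Fin m => M (w (Fin.castLE hm a)) (Fin.castLE hm b)).det := by
  rw [leadingMinor, AlgHom.map_det]
  congr 1
  ext a b
  simp [evalMat]

theorem evalMat_permMat_leadingMinor (w : Equiv.Perm (Fin n)) {m : ℕ} (hm : m ≤ n) :
    evalMat (permMat w) (leadingMinor w hm) = 1 := by
  rw [evalMat_leadingMinor]
  convert Matrix.det_one (n := Fin m) (R := ℂ)
  ext a b
  simp [permMat, Matrix.one_apply]

variable [NeZero n]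

/-- The first `k` entries of the first row of `M` vanish. -/
def FirstRowZero (k : ℕ) (M : Matrix (Fin n) (Fin n) ℂ) : Prop :=
  ∀ j : Fin n, (j : ℕ) < k → M 0 j = 0

/-- The first `k` columns of `M`, without their entries in the first row, are linearly dependent. -/
def LowerDependent (k : ℕ) (M : Matrix (Fin n) (Fin n) ℂ) : Prop :=
  ∃ w : Fin n → ℂ, w ≠ 0 ∧ (∀ j : Fin n, k ≤ (j : ℕ) → w j = 0) ∧
    ∀ a : Fin n, a ≠ 0 → (M.mulVec w) a = 0

/-- The places of the first `k` entries of the first row. -/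
def firstRowPlaces (n : ℕ) [NeZero n] (k : ℕ) : Set (Fin n × Fin n) :=
  {p | p.1 = 0 ∧ (p.2 : ℕ) < k}

theorem idealL_eq_span (k : ℕ) : idealL n k = Ideal.span (X '' firstRowPlaces n k) := by
  unfold idealL
  congr 1
  ext f
  constructor
  · rintro ⟨j, hj, rfl⟩
    exact ⟨(0, j), ⟨rfl, hj⟩, (genericZ_apply _ _).symm⟩
  · rintro ⟨⟨a, j⟩, ⟨ha, hj⟩, rfl⟩
    obtain rfl : a = 0 := ha
    exact ⟨j, hj, (genericZ_apply _ _).symm⟩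

theorem idealK_eq_maxMinors {k : ℕ} (hk : k ≤ n) :
    idealK n k = maxMinors ℂ (Finset.univ.erase (0 : Fin n)) (Fin.castLEEmb hk) := by
  apply le_antisymm
  · refine Ideal.span_le.mpr ?_
    rintro f ⟨B, hB, h0, rfl⟩
    refine Ideal.subset_span ⟨B.orderEmbOfFin hB, fun j => ?_, rfl⟩
    simp only [Finset.mem_erase, Finset.mem_univ, and_true]
    rintro h
    exact h0 (h ▸ B.orderEmbOfFin_mem hB j)
  · refine Ideal.span_le.mpr ?_
    rintro f ⟨r, hr, rfl⟩
    by_cases hinj : Function.Injective r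
    · have hB : (Finset.univ.image r).card = k := by
        rw [Finset.card_image_of_injective _ hinj]; simp
      set B := Finset.univ.image r with hBdef
      have hrB : ∀ a, r a ∈ B := fun a => Finset.mem_image_of_mem _ (Finset.mem_univ a)
      have hσinj : Function.Injective fun a => (B.orderIsoOfFin hB).symm ⟨r a, hrB a⟩ := by
        intro a b hab
        simpa using hinj.eq_iff.mp (by simpa using hab)
      let σ : Equiv.Perm (Fin k) := Equiv.ofBijective _ (Finite.injective_iff_bijective.mp hσinj)
      have hσ : ∀ a, B.orderEmbOfFin hB (σ a) = r a := by
        intro a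
        simp [σ, ← Finset.coe_orderIsoOfFin_apply]
      have h0 : (0 : Fin n) ∉ B := by
        intro h
        obtain ⟨a, -, ha⟩ := Finset.mem_image.mp h
        exact (Finset.mem_erase.mp (hr a)).1 ha
      have hdet : (Matrix.of fun a b : Fin k => (X (r a, Fin.castLEEmb hk b) : CoordRing n)).det =
          Equiv.Perm.sign σ * minorB B hB := by
        rw [minorB, ← Matrix.det_permute]
        congr 1
        ext a b : 2
        simp [hσ, genericZ_apply]
      rw [hdet]
      exact Ideal.mul_mem_left _ _ (Ideal.subset_span ⟨B, hB, h0, rfl⟩)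
    · obtain ⟨a, b, hab, hne⟩ : ∃ a b, r a = r b ∧ a ≠ b := by
        simpa [Function.Injective] using hinj
      rw [Matrix.det_zero_of_row_eq hne (by ext c; simp [hab])]
      exact Ideal.zero_mem _

theorem idealK_self : idealK n n = ⊥ := by
  rw [eq_bot_iff]
  refine Ideal.span_le.mpr ?_
  rintro f ⟨B, hB, h0, rfl⟩
  have := Finset.eq_univ_of_card B (by simpa using hB)
  exact absurd (this ▸ Finset.mem_univ _) h0

theorem firstRowPlaces_disjoint (k : ℕ) : ∀ a ∈ Finset.univ.erase (0 : Fin n), ∀ q : Fin n,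
    (a, q) ∉ firstRowPlaces n k :=
  fun _ ha _ h => (Finset.mem_erase.mp ha).1 h.1

theorem mem_dependentLocus_iff {i k : ℕ} (hk : k ≤ n) (M : Matrix (Fin n) (Fin n) ℂ) :
    (fun p : Fin n × Fin n => M p.1 p.2) ∈ dependentLocus ℂ (Finset.univ.erase (0 : Fin n))
      (Fin.castLEEmb hk) (firstRowPlaces n i) ↔ FirstRowZero i M ∧ LowerDependent k M := by
  have hsum : ∀ (v : Fin n → ℂ), (∀ j : Fin n, k ≤ (j : ℕ) → v j = 0) →
      ∑ b : Fin k, v (Fin.castLE hk b) = ∑ j, v j := by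
    intro v hv
    change ∑ b : Fin k, v (Fin.castLEEmb hk b) = _
    rw [← Finset.sum_map Finset.univ (Fin.castLEEmb hk) v]
    refine Finset.sum_subset (Finset.subset_univ _) fun j _ hj => hv j ?_
    by_contra! hlt
    exact hj (Finset.mem_map.mpr ⟨⟨j, hlt⟩, Finset.mem_univ _, rfl⟩)
  constructor
  · rintro ⟨w, hw, h1, h2⟩
    refine ⟨fun j hj => h1 (0, j) ⟨rfl, hj⟩, fun j => if h : (j : ℕ) < k then w ⟨j, h⟩ else 0,
      fun h => hw ?_, fun j hj => dif_neg (by omega), fun a ha => ?_⟩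
    · funext b
      have := congrFun h (Fin.castLE hk b)
      simpa using this
    · refine Eq.trans ?_ (h2 a (by simp [ha]))
      rw [Matrix.mulVec, dotProduct, ← hsum]
      · refine Finset.sum_congr rfl fun b _ => ?_
        simp
      · intro j hj
        simp [hj.not_gt]
  · rintro ⟨hL, w, hw, hw0, h2⟩
    refine ⟨fun b => w (Fin.castLE hk b), fun h => hw ?_, ?_, fun a ha => ?_⟩
    · funext j
      by_cases hj : (j : ℕ) < k
      · exact congrFun h ⟨j, hj⟩
      · exact hw0 j (by omega)
    · rintro ⟨a, j⟩ ⟨rfl : a = 0, hj⟩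
      exact hL j hj
    · rw [← h2 a (Finset.mem_erase.mp ha).1, Matrix.mulVec, dotProduct, ← hsum]
      · rfl
      · intro j hj
        simp [hw0 j hj]

theorem idealL_sup_idealK_eq (i : ℕ) {k : ℕ} (hk : k ≤ n) :
    idealL n i ⊔ idealK n k = vanishingIdeal ℂ (dependentLocus ℂ (Finset.univ.erase (0 : Fin n))
      (Fin.castLEEmb hk) (firstRowPlaces n i)) := by
  rw [vanishingIdeal_dependentLocus _ (firstRowPlaces_disjoint i), idealL_eq_span,
    idealK_eq_maxMinors hk, sup_comm]

theorem mem_idealL_sup_idealK_iff {i k : ℕ} (hk : k ≤ n) {f : CoordRing n} :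
    f ∈ idealL n i ⊔ idealK n k ↔
      ∀ M : Matrix (Fin n) (Fin n) ℂ, FirstRowZero i M → LowerDependent k M → evalMat M f = 0 := by
  rw [idealL_sup_idealK_eq i hk]
  constructor
  · exact fun h M h1 h2 => h _ ((mem_dependentLocus_iff hk M).mpr ⟨h1, h2⟩)
  · intro h x hx
    let M : Matrix (Fin n) (Fin n) ℂ := Matrix.of fun a b => x (a, b)
    have hM : (fun p : Fin n × Fin n => M p.1 p.2) = x := rfl
    rw [← hM] at hx ⊢
    obtain ⟨h1, h2⟩ := (mem_dependentLocus_iff hk M).mp hx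
    exact h M h1 h2

theorem idealL_sup_idealK_isPrime (i : ℕ) {k : ℕ} (hk : k ≤ n) (hk0 : k ≠ 0) :
    (idealL n i ⊔ idealK n k).IsPrime := by
  obtain ⟨k, rfl⟩ := Nat.exists_eq_succ_of_ne_zero hk0
  rw [idealL_sup_idealK_eq i hk]
  exact vanishingIdeal_dependentLocus_isPrime _ (firstRowPlaces_disjoint i)

theorem mem_idealL_iff {k : ℕ} {f : CoordRing n} :
    f ∈ idealL n k ↔ ∀ M : Matrix (Fin n) (Fin n) ℂ, FirstRowZero k M → evalMat M f = 0 := by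
  rw [idealL_eq_span]
  constructor
  · intro hf M hM
    have h : Ideal.span (X '' firstRowPlaces n k) ≤ RingHom.ker (evalMat M) := by
      refine Ideal.span_le.mpr ?_
      rintro g ⟨⟨a, j⟩, ⟨rfl : a = 0, hj⟩, rfl⟩
      simpa [evalMat, RingHom.mem_ker] using hM j hj
    exact h hf
  · intro h
    refine vanishingIdeal_coordinateSubspace _ fun x hx => ?_
    exact h (Matrix.of fun a b => x (a, b)) fun j hj => hx (0, j) ⟨rfl, hj⟩

theorem idealL_zero : idealL n 0 = ⊥ := by
  rw [idealL, Ideal.span_eq_bot]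
  rintro f ⟨j, hj, -⟩
  omega

theorem idealL_mono {k l : ℕ} (h : k ≤ l) : idealL n k ≤ idealL n l := by
  refine Ideal.span_mono ?_
  rintro f ⟨j, hj, rfl⟩
  exact ⟨j, hj.trans_le h, rfl⟩

theorem mem_idealK_iff {k : ℕ} (hk : k ≤ n) {f : CoordRing n} :
    f ∈ idealK n k ↔
      ∀ M : Matrix (Fin n) (Fin n) ℂ, LowerDependent k M → evalMat M f = 0 := by
  have := mem_idealL_sup_idealK_iff (i := 0) hk (f := f)
  rw [idealL_zero, bot_sup_eq] at this
  rw [this]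
  exact forall_congr' fun M => ⟨fun h => h fun j hj => absurd hj (Nat.not_lt_zero _), fun h _ => h⟩

theorem LowerDependent.mono {k l : ℕ} (h : k ≤ l) {M : Matrix (Fin n) (Fin n) ℂ}
    (hM : LowerDependent k M) : LowerDependent l M := by
  obtain ⟨w, h0, h1, h2⟩ := hM
  exact ⟨w, h0, fun j hj => h1 j (h.trans hj), h2⟩

theorem idealK_anti {k l : ℕ} (h : k ≤ l) (hl : l ≤ n) : idealK n l ≤ idealK n k := by
  intro f hf
  rw [mem_idealK_iff (h.trans hl)]
  exact fun M hM => (mem_idealK_iff hl).mp hf M (hM.mono h)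

theorem idealL_isPrime (k : ℕ) : (idealL n k).IsPrime := by
  have := idealL_sup_idealK_isPrime (n := n) k le_rfl (NeZero.ne n)
  rwa [idealK_self, sup_bot_eq] at this

theorem idealK_isPrime {k : ℕ} (hk : k ≤ n) (hk0 : k ≠ 0) : (idealK n k).IsPrime := by
  have := idealL_sup_idealK_isPrime (n := n) 0 hk hk0
  rwa [idealL_zero, bot_sup_eq] at this

theorem cornerIdeal_isPrime (h : Fin n → Fin n) (i : Fin n) : (cornerIdeal h i).IsPrime :=
  idealL_sup_idealK_isPrime _ (h i).isLt (Nat.succ_ne_zero _)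

/-! ### Permutation matrices in the loci -/

theorem permU_apply_eq_zero_iff {q j : Fin n} : permU q j = 0 ↔ j = q := by
  have h : permU q q = 0 := Fin.cycleRange_self q
  rw [← h]
  exact (permU q).injective.eq_iff

theorem det_permMat_ne_zero {m : ℕ} (w : Equiv.Perm (Fin m)) : (permMat w).det ≠ 0 := by
  have h : permMat w = (1 : Matrix (Fin m) (Fin m) ℂ).submatrix id w := by
    ext i j
    simp [permMat, Matrix.one_apply]
  rw [h, Matrix.det_permute']
  simp

theorem evalMat_det_genericZ {m : ℕ} (M : Matrix (Fin m) (Fin m) ℂ) :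
    evalMat M (genericZ m).det = M.det := by
  rw [AlgHom.map_det]
  congr 1
  ext i j
  simp [genericZ_apply, evalMat]

theorem firstRowZero_permMat {w : Equiv.Perm (Fin n)} {i q : Fin n} (hw : w q = 0) (h : i ≤ q) :
    FirstRowZero (i : ℕ) (permMat w) := by
  intro j hj
  simp only [permMat, Matrix.of_apply]
  rw [if_neg]
  rintro h0
  rw [w.injective (h0.symm.trans hw.symm)] at hj
  exact absurd hj (not_lt.mpr h)

theorem permMat_mulVec_single {m : ℕ} (w : Equiv.Perm (Fin m)) (q a : Fin m) :
    (permMat w).mulVec (Pi.single q 1) a = if a = w q then 1 else 0 := by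
  simp [permMat]

theorem lowerDependent_permMat {w : Equiv.Perm (Fin n)} {q : Fin n} (hw : w q = 0) {k : ℕ}
    (h : (q : ℕ) < k) : LowerDependent k (permMat w) := by
  refine ⟨Pi.single q 1, fun h => by simpa using congrFun h q, fun j hj => ?_, fun a ha => ?_⟩
  · rw [Pi.single_eq_of_ne]
    rintro rfl
    omega
  · rw [permMat_mulVec_single, if_neg]
    rwa [hw]

theorem exists_mem_idealL_evalMat_ne_zero {q : Fin n} {k : ℕ} (h : (q : ℕ) < k) :
    ∃ f ∈ idealL n k, evalMat (permMat (permU q)) f ≠ 0 := by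
  refine ⟨_, Ideal.subset_span ⟨q, h, rfl⟩, ?_⟩
  simp [genericZ_apply, evalMat, permMat, permU_apply_eq_zero_iff.mpr rfl]

theorem exists_mem_idealK_evalMat_ne_zero {q : Fin n} {k : ℕ} (h : k ≤ (q : ℕ)) :
    ∃ f ∈ idealK n k, evalMat (permMat (permU q)) f ≠ 0 := by
  have hk : k ≤ n := h.trans q.isLt.le
  rw [idealK_eq_maxMinors hk]
  refine ⟨_, Ideal.subset_span ⟨fun a => permU q (Fin.castLE hk a), fun a => ?_, rfl⟩, ?_⟩
  · simp only [Finset.mem_erase, Finset.mem_univ, and_true, Ne, permU_apply_eq_zero_iff]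
    rintro h1
    have := a.isLt
    rw [← h1, Fin.val_castLE] at h
    omega
  · exact (evalMat_permMat_leadingMinor (permU q) hk).trans_ne one_ne_zero

theorem det_notMem_idealL_sup_idealK {i q : Fin n} {k : ℕ} (hk : k ≤ n) (h : i ≤ q)
    (h' : (q : ℕ) < k) : (genericZ n).det ∉ idealL n i ⊔ idealK n k := by
  intro hdet
  have := (mem_idealL_sup_idealK_iff hk).mp hdet _
    (firstRowZero_permMat (permU_apply_eq_zero_iff.mpr rfl) h)
    (lowerDependent_permMat (permU_apply_eq_zero_iff.mpr rfl) h')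
  rw [evalMat_det_genericZ] at this
  exact det_permMat_ne_zero _ this

theorem det_notMem_cornerIdeal {h : Fin n → Fin n} (hh : IsHessenberg h) (i : Fin n) :
    (genericZ n).det ∉ cornerIdeal h i :=
  det_notMem_idealL_sup_idealK (h i).isLt le_rfl (Nat.lt_succ_of_le (hh.2 i))

theorem corners_lt {m : ℕ} {h : Fin m → Fin m} (hh : IsHessenberg h) {i j : Fin m}
    (hj : j ∈ corners h) (hij : i < j) : h i < h j := by
  have hj0 : (j : ℕ) - 1 + 1 = j := by
    have : (i : ℕ) < j := hij
    omega
  let j' : Fin m := ⟨j - 1, by have := j.isLt; omega⟩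
  refine lt_of_le_of_lt (hh.1 ?_) (hj j' hj0)
  change (i : ℕ) ≤ j - 1
  have : (i : ℕ) < j := hij
  omega

/-- The ideals at different corners are separated by the permutation matrices `u[q]`: such a matrix
lies in the zero locus of the ideal at `i` exactly when `i ≤ q ≤ h(i)`. -/
theorem eq_of_cornerIdeal_le {h : Fin n → Fin n} (hh : IsHessenberg h) {i j : Fin n}
    (hj : j ∈ corners h) (hle : cornerIdeal h i ≤ cornerIdeal h j) :
    i = j := by
  have key : ∀ q : Fin n, j ≤ q → q ≤ h j → i ≤ q ∧ q ≤ h i := by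
    intro q h1 h2
    have hvan : ∀ f ∈ cornerIdeal h i, evalMat (permMat (permU q)) f = 0 := fun f hf =>
      (mem_idealL_sup_idealK_iff (h j).isLt).mp (hle hf) _
        (firstRowZero_permMat (permU_apply_eq_zero_iff.mpr rfl) h1)
        (lowerDependent_permMat (permU_apply_eq_zero_iff.mpr rfl) (Nat.lt_succ_of_le h2))
    constructor
    · by_contra! hlt
      obtain ⟨f, hf, hne⟩ := exists_mem_idealL_evalMat_ne_zero (n := n) (q := q) (k := i) hlt
      exact hne (hvan f (Ideal.mem_sup_left hf))
    · by_contra! hlt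
      obtain ⟨f, hf, hne⟩ := exists_mem_idealK_evalMat_ne_zero (n := n) (q := q) (k := h i + 1) hlt
      exact hne (hvan f (Ideal.mem_sup_right hf))
  have h1 := (key j le_rfl (hh.2 j)).1
  have h2 := (key (h j) (hh.2 j) le_rfl).2
  by_contra hne
  exact absurd (corners_lt hh hj (lt_of_le_of_ne h1 hne)) (not_lt.mpr h2)

end CornerIdeals

section Schubert

open MvPolynomial

/-! ### Double cosets and elimination -/

variable {n : ℕ}

theorem mem_idealOfSet_iff {S : Set (GL (Fin n) ℂ)} {f : CoordRing n} :
    f ∈ idealOfSet S ↔ ∀ g ∈ S, evalMat (g : Matrix (Fin n) (Fin n) ℂ) f = 0 := by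
  simp [idealOfSet, RingHom.mem_ker]

/-- The permutation matrix as an invertible matrix. -/
noncomputable def permGL {m : ℕ} (w : Equiv.Perm (Fin m)) : GL (Fin m) ℂ :=
  Matrix.GeneralLinearGroup.mkOfDetNeZero (permMat w) (det_permMat_ne_zero w)

theorem mul_permMat_apply {m : ℕ} (A : Matrix (Fin m) (Fin m) ℂ) (w : Equiv.Perm (Fin m))
    (p j : Fin m) : (A * permMat w) p j = A p (w j) := by
  simp [Matrix.mul_apply, permMat]

theorem permMat_mul_apply {m : ℕ} (A : Matrix (Fin m) (Fin m) ℂ) (w : Equiv.Perm (Fin m))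
    (q j : Fin m) : (permMat w * A) (w q) j = A q j := by
  simp [Matrix.mul_apply, permMat]

/-- Column operations bring an invertible matrix into `H ẇ`: it lies in `H ẇ B` if there are
vectors `β j` with last nonzero coordinate `j`, such that the matrix `a` with columns
`a e_{w(j)} = g β j` lies in `H`. -/
theorem mem_doubleCoset_of_columns {m : ℕ} {H : Subgroup (GL (Fin m) ℂ)} (w : Equiv.Perm (Fin m))
    (g : GL (Fin m) ℂ) (β : Fin m → Fin m → ℂ) (hβ : ∀ j q, j < q → β j q = 0)
    (hβj : ∀ j, β j j ≠ 0)
    (hH : ∀ a : GL (Fin m) ℂ, (∀ p j, (a : Matrix (Fin m) (Fin m) ℂ) p (w j) =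
      ((g : Matrix (Fin m) (Fin m) ℂ).mulVec (β j)) p) → a ∈ H) :
    g ∈ doubleCoset H w := by
  let b : Matrix (Fin m) (Fin m) ℂ := Matrix.of fun q j => β j q
  have hb : Matrix.BlockTriangular b id := fun q j hjq => hβ j q hjq
  have hdet : b.det ≠ 0 := by
    rw [Matrix.det_of_isUpperTriangular hb]
    exact Finset.prod_ne_zero_iff.mpr fun j _ => hβj j
  let bG : GL (Fin m) ℂ := Matrix.GeneralLinearGroup.mkOfDetNeZero b hdet
  have hbG : bG ∈ borel m := hb
  let a : GL (Fin m) ℂ := g * bG * (permGL w)⁻¹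
  have ha : a * permGL w = g * bG := by simp [a]
  refine ⟨a, hH a fun p j => ?_, bG⁻¹, inv_mem hbG, ?_⟩
  · rw [← mul_permMat_apply (a : Matrix (Fin m) (Fin m) ℂ) w p j]
    have := congrArg (fun x : GL (Fin m) ℂ => (x : Matrix (Fin m) (Fin m) ℂ) p j) ha
    exact this
  · have : g = a * permGL w * bG⁻¹ := by rw [ha]; simp
    exact congrArg (fun x : GL (Fin m) ℂ => (x : Matrix (Fin m) (Fin m) ℂ)) this

theorem mulVec_castLE {m k : ℕ} (hk : k ≤ m) (M : Matrix (Fin m) (Fin m) ℂ) (b : Fin m → ℂ)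
    (hb : ∀ q : Fin m, k ≤ (q : ℕ) → b q = 0) (p : Fin m) :
    M.mulVec b p = ∑ q : Fin k, M p (Fin.castLE hk q) * b (Fin.castLE hk q) := by
  change _ = ∑ q : Fin k, (fun j => M p j * b j) (Fin.castLEEmb hk q)
  rw [← Finset.sum_map Finset.univ (Fin.castLEEmb hk) (fun j => M p j * b j)]
  symm
  refine Finset.sum_subset (Finset.subset_univ _) fun j _ hj => ?_
  rw [hb j, mul_zero]
  by_contra! hlt
  exact hj (Finset.mem_map.mpr ⟨⟨j, hlt⟩, Finset.mem_univ _, rfl⟩)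

theorem eq_of_w0_mul_permV_lt {k j q : Fin n} (hjq : j < q)
    (h : (w0 n * permV k) j < (w0 n * permV k) q) : j = k := by
  have hinv : (q.rev, j.rev) ∈ inversions (permU k.rev) := by
    simp only [inversions, Finset.mem_filter, Finset.mem_univ, true_and, Fin.rev_lt_rev]
    refine ⟨hjq, ?_⟩
    simpa [permV] using h
  rw [inversions_permU] at hinv
  have : j.rev = k.rev := by simpa using (Finset.mem_filter.mp hinv).2.2
  exact Fin.rev_injective this

theorem eq_zero_of_leadingMinor_ne_zero {w : Equiv.Perm (Fin n)} {k : ℕ} {hk : k ≤ n}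
    {M : Matrix (Fin n) (Fin n) ℂ} (hM : evalMat M (leadingMinor w hk) ≠ 0) {b : Fin n → ℂ}
    (hb : ∀ q : Fin n, k ≤ (q : ℕ) → b q = 0)
    (h : ∀ p : Fin n, (p : ℕ) < k → M.mulVec b (w p) = 0) : b = 0 := by
  rw [evalMat_leadingMinor] at hM
  have h0 : (fun q : Fin k => b (Fin.castLE hk q)) = 0 := by
    refine Matrix.eq_zero_of_mulVec_eq_zero hM ?_
    funext p
    have := h (Fin.castLE hk p) (by simp)
    rw [mulVec_castLE hk M b hb] at this
    exact this
  funext q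
  by_cases hq : (q : ℕ) < k
  · exact congrFun h0 ⟨q, hq⟩
  · exact hb q (by omega)

theorem exists_mulVec_of_leadingMinor_ne_zero {w : Equiv.Perm (Fin n)} {k : ℕ} {hk : k ≤ n}
    {M : Matrix (Fin n) (Fin n) ℂ} (hM : evalMat M (leadingMinor w hk) ≠ 0) (y : Fin n → ℂ) :
    ∃ b : Fin n → ℂ, (∀ q : Fin n, k ≤ (q : ℕ) → b q = 0) ∧
      ∀ p : Fin n, (p : ℕ) < k → M.mulVec b (w p) = y p := by
  rw [evalMat_leadingMinor] at hM
  set N : Matrix (Fin k) (Fin k) ℂ :=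
    Matrix.of fun a b : Fin k => M (w (Fin.castLE hk a)) (Fin.castLE hk b) with hN
  have hu : IsUnit N.det := isUnit_iff_ne_zero.mpr hM
  let b' : Fin k → ℂ := N⁻¹.mulVec fun p => y (Fin.castLE hk p)
  have hb' : N.mulVec b' = fun p => y (Fin.castLE hk p) := by
    simp [b', Matrix.mulVec_mulVec, Matrix.mul_nonsing_inv N hu]
  have hb0 : ∀ q : Fin n, k ≤ (q : ℕ) → (if h : (q : ℕ) < k then b' ⟨q, h⟩ else 0) = 0 :=
    fun q hq => dif_neg (by omega)
  refine ⟨fun q => if h : (q : ℕ) < k then b' ⟨q, h⟩ else 0, hb0, fun p hp => ?_⟩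
  rw [mulVec_castLE hk M _ hb0]
  have := congrFun hb' ⟨p, hp⟩
  rw [Matrix.mulVec, dotProduct] at this
  refine Eq.trans ?_ this
  refine Finset.sum_congr rfl fun q _ => ?_
  simp [hN]

/-- Gaussian elimination: if the leading principal minors of `ẇ⁻¹ M` do not vanish, then some
combination of the first `j` columns, involving the `j`-th column, has zeros in the rows
`w(1), …, w(j-1)`. -/
theorem exists_column {w : Equiv.Perm (Fin n)} {M : Matrix (Fin n) (Fin n) ℂ}
    (hM : ∀ (m : ℕ) (hm : m ≤ n), evalMat M (leadingMinor w hm) ≠ 0) (j : Fin n) :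
    ∃ b : Fin n → ℂ, (∀ q, j < q → b q = 0) ∧ b j ≠ 0 ∧ ∀ p, p < j → M.mulVec b (w p) = 0 := by
  obtain ⟨b, hb, hbw⟩ := exists_mulVec_of_leadingMinor_ne_zero (hM (j + 1) j.isLt) (Pi.single j 1)
  refine ⟨b, fun q hq => hb q hq, fun h0 => ?_, fun p hp => ?_⟩
  · have hzero : b = 0 := by
      refine eq_zero_of_leadingMinor_ne_zero (hM j j.isLt.le) (fun q hq => ?_) fun p hp => ?_
      · rcases Nat.eq_or_lt_of_le hq with h | h
        · rwa [← Fin.ext h]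
        · exact hb q h
      · rw [hbw p (hp.trans (Nat.lt_succ_self _)), Pi.single_eq_of_ne]
        rintro rfl
        exact lt_irrefl _ hp
    have := hbw j (Nat.lt_succ_self _)
    simp [hzero] at this
  · rw [hbw p (Nat.lt_succ_of_lt hp), Pi.single_eq_of_ne hp.ne]

/-- Let `I` be the ideal of a set `V` of matrices that contains `ẇ`. If `I` is prime and the
invertible matrices in `V` with nonzero leading principal minors of `ẇ⁻¹ M` lie in `S`, then these
are dense in `V`, and polynomials that vanish on `S` lie in `I`. -/
theorem idealOfSet_le_of_dense {S : Set (GL (Fin n) ℂ)} (w : Equiv.Perm (Fin n))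
    {I : Ideal (CoordRing n)} [hI : I.IsPrime] (V : Set (Matrix (Fin n) (Fin n) ℂ))
    (hIV : ∀ f, f ∈ I ↔ ∀ M ∈ V, evalMat M f = 0) (hwV : permMat w ∈ V)
    (hS : ∀ g : GL (Fin n) ℂ, (g : Matrix (Fin n) (Fin n) ℂ) ∈ V →
      (∀ (m : ℕ) (hm : m ≤ n), evalMat (g : Matrix (Fin n) (Fin n) ℂ) (leadingMinor w hm) ≠ 0) →
      g ∈ S) :
    idealOfSet S ≤ I := by
  intro f hf
  rw [mem_idealOfSet_iff] at hf
  let δ : CoordRing n := (genericZ n).det *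
    ∏ m : Fin (n + 1), leadingMinor w (Nat.lt_succ_iff.mp m.isLt)
  have hδ : δ ∉ I := by
    intro h
    have := (hIV δ).mp h _ hwV
    rw [map_mul, evalMat_det_genericZ, map_prod] at this
    simp [evalMat_permMat_leadingMinor, det_permMat_ne_zero] at this
  refine (hI.mem_or_mem (x := f) (y := δ) ?_).resolve_right hδ
  rw [hIV]
  intro M hM
  rw [map_mul]
  by_cases h0 : evalMat M δ = 0
  · rw [h0, mul_zero]
  rw [map_mul, evalMat_det_genericZ, map_prod] at h0
  have h1 := left_ne_zero_of_mul h0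
  have h2 := Finset.prod_ne_zero_iff.mp (right_ne_zero_of_mul h0)
  have h3 := hf (Matrix.GeneralLinearGroup.mkOfDetNeZero M h1)
    (hS _ hM fun m hm => h2 ⟨m, Nat.lt_succ_of_le hm⟩ (Finset.mem_univ _))
  have h4 : evalMat M f = 0 := h3
  rw [h4, zero_mul]

/-! ### The ideals of the matrix Schubert varieties -/

variable [NeZero n]

theorem firstRowZero_of_mem_doubleCoset {i : Fin n} {g : GL (Fin n) ℂ}
    (hg : g ∈ doubleCoset (borelOp n) (permU i)) :
    FirstRowZero (i : ℕ) (g : Matrix (Fin n) (Fin n) ℂ) := by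
  obtain ⟨a, ha, b, hb, hg⟩ := hg
  intro j hj
  have ha0 : ∀ p : Fin n, p ≠ 0 → (a : Matrix (Fin n) (Fin n) ℂ) 0 p = 0 := fun p hp =>
    ha (OrderDual.toDual_lt_toDual.mpr (Fin.pos_iff_ne_zero.mpr hp))
  have hb0 : (b : Matrix (Fin n) (Fin n) ℂ) i j = 0 := hb hj
  rw [hg, mul_assoc, Matrix.mul_apply, Finset.sum_eq_single 0]
  · conv_lhs => rw [← (permU_apply_eq_zero_iff (q := i) (j := i)).mpr rfl]
    rw [permMat_mul_apply, hb0, mul_zero]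
  · intro p _ hp
    rw [ha0 p hp, zero_mul]
  · simp

/-- The ideal of the opposite matrix Schubert variety of `u[i]`. -/
theorem idealOfSet_doubleCoset_permU (i : Fin n) :
    idealOfSet (doubleCoset (borelOp n) (permU i)) = idealL n i := by
  apply le_antisymm
  · have := idealL_isPrime (n := n) i
    refine idealOfSet_le_of_dense (permU i) {M | FirstRowZero (i : ℕ) M}
      (fun f => mem_idealL_iff) (firstRowZero_permMat (permU_apply_eq_zero_iff.mpr rfl) le_rfl)
      fun g hg hmin => ?_
    choose β hβ hβj hβ0 using exists_column hmin
    refine mem_doubleCoset_of_columns _ g β hβ hβj fun a ha p r hpr => ?_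
    obtain ⟨j, rfl⟩ := (permU i).surjective r
    obtain ⟨q, rfl⟩ := (permU i).surjective p
    rw [ha]
    have hlt : permU i q < permU i j := hpr
    rcases lt_trichotomy q j with h | h | h
    · exact hβ0 j q h
    · rw [h] at hlt
      exact absurd hlt (lt_irrefl _)
    · -- the only inversions of `u[i]` are those with the position `i`
      have hinv : (j, q) ∈ inversions (permU i) := by
        simp [inversions, h, hlt]
      rw [inversions_permU] at hinv
      obtain ⟨-, rfl⟩ : j < q ∧ q = i := by simpa using hinv
      rw [permU_apply_eq_zero_iff.mpr rfl]
      rw [Matrix.mulVec, dotProduct]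
      refine Finset.sum_eq_zero fun b _ => ?_
      rcases le_or_gt b j with hb | hb
      · rw [hg b (lt_of_le_of_lt hb h), zero_mul]
      · rw [hβ j b hb, mul_zero]
  · intro f hf
    rw [mem_idealOfSet_iff]
    exact fun g hg => mem_idealL_iff.mp hf _ (firstRowZero_of_mem_doubleCoset hg)

theorem w0_mul_permV_apply (k : Fin n) : (w0 n * permV k) k = 0 := by
  rw [Equiv.Perm.mul_apply, (permV_shortest k).1]
  simp

theorem lowerDependent_of_mem_doubleCoset {k : Fin n} {g : GL (Fin n) ℂ}
    (hg : g ∈ doubleCoset (borel n) (w0 n * permV k)) :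
    LowerDependent ((k : ℕ) + 1) (g : Matrix (Fin n) (Fin n) ℂ) := by
  obtain ⟨a, ha, b, hb, hg⟩ := hg
  have hbi : b⁻¹ ∈ borel n := inv_mem hb
  have hbb : (b : Matrix (Fin n) (Fin n) ℂ) * ((b⁻¹ : GL (Fin n) ℂ) : Matrix (Fin n) (Fin n) ℂ)
      = 1 := by
    rw [← Units.val_mul, mul_inv_cancel, Units.val_one]
  have hcol : ∀ j, ((g : Matrix (Fin n) (Fin n) ℂ).mulVec
      (((b⁻¹ : GL (Fin n) ℂ) : Matrix (Fin n) (Fin n) ℂ).mulVec (Pi.single k 1))) j =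
      (a : Matrix (Fin n) (Fin n) ℂ) j 0 := by
    intro j
    rw [Matrix.mulVec_mulVec, hg, mul_assoc, hbb, mul_one]
    simp [mul_permMat_apply, ← w0_mul_permV_apply k]
  refine ⟨((b⁻¹ : GL (Fin n) ℂ) : Matrix (Fin n) (Fin n) ℂ).mulVec (Pi.single k 1),
    fun h0 => ?_, fun j hj => ?_, fun p hp => ?_⟩
  · have h1 := congrArg (fun v => (b : Matrix (Fin n) (Fin n) ℂ).mulVec v k) h0
    rw [Matrix.mulVec_mulVec, hbb] at h1
    simp at h1
  · simpa using hbi (show k < j from hj)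
  · rw [hcol]
    exact ha (Fin.pos_iff_ne_zero.mpr hp)

/-- The ideal of the matrix Schubert variety of `w₀ v[k]`. -/
theorem idealOfSet_doubleCoset_permV (k : Fin n) :
    idealOfSet (doubleCoset (borel n) (w0 n * permV k)) = idealK n ((k : ℕ) + 1) := by
  apply le_antisymm
  · have := idealK_isPrime (n := n) (k := (k : ℕ) + 1) k.isLt (Nat.succ_ne_zero _)
    refine idealOfSet_le_of_dense (w0 n * permV k) {M | LowerDependent ((k : ℕ) + 1) M}
      (fun f => mem_idealK_iff k.isLt)
      (lowerDependent_permMat (w0_mul_permV_apply k) (Nat.lt_succ_self _)) fun g hg hmin => ?_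
    choose β hβ hβj hβ0 using exists_column hmin
    obtain ⟨c, hc, hcs, hcker⟩ := hg
    have hck : c k ≠ 0 := by
      intro h0
      refine hc (eq_zero_of_leadingMinor_ne_zero (hmin k k.isLt.le) (fun q hq => ?_) fun p hp => ?_)
      · rcases Nat.eq_or_lt_of_le hq with h | h
        · rwa [← Fin.ext h]
        · exact hcs q h
      · refine hcker _ fun h => ?_
        have := (w0 n * permV k).injective (h.trans (w0_mul_permV_apply k).symm)
        exact absurd hp (by rw [this]; exact lt_irrefl _)
    refine mem_doubleCoset_of_columns _ g (Function.update β k c) (fun j q hjq => ?_)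
      (fun j => ?_) fun a ha p r hpr => ?_
    · by_cases hj : j = k
      · subst hj
        rw [Function.update_self]
        exact hcs q hjq
      · rw [Function.update_of_ne hj]
        exact hβ j q hjq
    · by_cases hj : j = k
      · subst hj
        rwa [Function.update_self]
      · rw [Function.update_of_ne hj]
        exact hβj j
    · obtain ⟨j, rfl⟩ := (w0 n * permV k).surjective r
      rw [ha]
      by_cases hj : j = k
      · subst hj
        rw [Function.update_self]
        refine hcker p ?_
        rintro rfl
        exact absurd hpr (Fin.not_lt_zero _)
      · rw [Function.update_of_ne hj]
        obtain ⟨q, rfl⟩ := (w0 n * permV k).surjective p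
        rcases lt_trichotomy q j with h | h | h
        · exact hβ0 j q h
        · rw [h] at hpr
          exact absurd hpr (lt_irrefl _)
        · exact absurd (eq_of_w0_mul_permV_lt h hpr) hj
  · intro f hf
    rw [mem_idealOfSet_iff]
    exact fun g hg => (mem_idealK_iff k.isLt).mp hf _ (lowerDependent_of_mem_doubleCoset hg)

/-! ### Closures in the flag variety and Richardson varieties -/

/-- Zariski closures in `GL_n` of right `B`-invariant sets are preimages of closures in `G / B`. -/
theorem flagπ_mem_flagClosure_iff {m : ℕ} {D : Set (GL (Fin m) ℂ)}
    (hD : ∀ g ∈ D, ∀ b ∈ borel m, g * b ∈ D) (g : GL (Fin m) ℂ) :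
    flagπ g ∈ flagClosure (flagπ '' D) ↔
      ∀ f ∈ idealOfSet D, evalMat (g : Matrix (Fin m) (Fin m) ℂ) f = 0 := by
  let C : Set (GL (Fin m) ℂ) :=
    {g | ∀ f ∈ idealOfSet D, evalMat (g : Matrix (Fin m) (Fin m) ℂ) f = 0}
  have hCinv : ∀ g ∈ C, ∀ b ∈ borel m, g * b ∈ C := by
    intro g hg b hb f hf
    -- right translation by `b` acts on polynomials
    let ρ : CoordRing m →ₐ[ℂ] CoordRing m := aeval fun p : Fin m × Fin m =>
      ∑ q, X (p.1, q) * MvPolynomial.C ((b : Matrix (Fin m) (Fin m) ℂ) q p.2)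
    have hρ : ∀ (x : GL (Fin m) ℂ) (f : CoordRing m),
        evalMat (x : Matrix (Fin m) (Fin m) ℂ) (ρ f) =
          evalMat ((x * b : GL (Fin m) ℂ) : Matrix (Fin m) (Fin m) ℂ) f := by
      intro x f
      have : (evalMat (x : Matrix (Fin m) (Fin m) ℂ)).comp ρ =
          evalMat ((x * b : GL (Fin m) ℂ) : Matrix (Fin m) (Fin m) ℂ) := by
        ext p
        simp [ρ, evalMat, Matrix.mul_apply]
      exact congrArg (fun φ => φ f) this
    rw [← hρ]
    refine hg _ (mem_idealOfSet_iff.mpr fun x hx => ?_)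
    rw [hρ]
    exact mem_idealOfSet_iff.mp hf _ (hD x hx b hb)
  constructor
  · intro h
    have hpre : flagπ ⁻¹' (flagπ '' C) = C := by
      ext x
      constructor
      · rintro ⟨y, hy, hxy⟩
        have h1 : y⁻¹ * x ∈ borel m := QuotientGroup.eq.mp hxy
        have h2 := hCinv y hy _ h1
        rwa [mul_inv_cancel_left] at h2
      · exact fun hx => ⟨x, hx, rfl⟩
    have h1 := h (flagπ '' C) ⟨Set.image_mono fun x hx f hf => mem_idealOfSet_iff.mp hf x hx, by
      rw [hpre]
      exact ⟨idealOfSet D, rfl⟩⟩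
    have h2 : g ∈ flagπ ⁻¹' (flagπ '' C) := h1
    rwa [hpre] at h2
  · rintro h F ⟨hDF, P, hP⟩
    change g ∈ flagπ ⁻¹' F
    rw [hP]
    intro f hf
    refine h f (mem_idealOfSet_iff.mpr fun x hx => ?_)
    have : x ∈ flagπ ⁻¹' F := hDF ⟨x, hx, rfl⟩
    rw [hP] at this
    exact this f hf

theorem mul_mem_doubleCoset {m : ℕ} {H : Subgroup (GL (Fin m) ℂ)} {w : Equiv.Perm (Fin m)}
    {g b : GL (Fin m) ℂ} (hg : g ∈ doubleCoset H w) (hb : b ∈ borel m) :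
    g * b ∈ doubleCoset H w := by
  obtain ⟨a, ha, c, hc, h⟩ := hg
  exact ⟨a, ha, c * b, mul_mem hc hb, by rw [Units.val_mul, h, Units.val_mul, mul_assoc]⟩

theorem flagπ_mem_schubertOp_iff (i : Fin n) (g : GL (Fin n) ℂ) :
    flagπ g ∈ schubertOp (permU i) ↔
      ∀ f ∈ idealL n i, evalMat (g : Matrix (Fin n) (Fin n) ℂ) f = 0 := by
  rw [← idealOfSet_doubleCoset_permU]
  exact flagπ_mem_flagClosure_iff (fun _ hg _ hb => mul_mem_doubleCoset hg hb) g

theorem flagπ_mem_schubert_iff (k : Fin n) (g : GL (Fin n) ℂ) :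
    flagπ g ∈ schubert (w0 n * permV k) ↔
      ∀ f ∈ idealK n ((k : ℕ) + 1), evalMat (g : Matrix (Fin n) (Fin n) ℂ) f = 0 := by
  rw [← idealOfSet_doubleCoset_permV]
  exact flagπ_mem_flagClosure_iff (fun _ hg _ hb => mul_mem_doubleCoset hg hb) g

theorem richardson_nonempty {i k : Fin n} (hik : i ≤ k) :
    (schubertOp (permU i) ∩ schubert (w0 n * permV k)).Nonempty := by
  have h0 : permU i i = 0 := permU_apply_eq_zero_iff.mpr rfl
  refine ⟨flagπ (permGL (permU i)), ?_, ?_⟩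
  · rw [flagπ_mem_schubertOp_iff]
    exact fun f hf => mem_idealL_iff.mp hf _ (firstRowZero_permMat h0 le_rfl)
  · rw [flagπ_mem_schubert_iff]
    exact fun f hf => (mem_idealK_iff k.isLt).mp hf _
      (lowerDependent_permMat h0 (Nat.lt_succ_of_le hik))

/-- The sum of the ideals of the two matrix Schubert varieties is already the ideal of the matrix
Richardson variety: it is prime and does not contain the determinant. -/
theorem idealOfSet_richardson {i k : Fin n} (hik : i ≤ k) :
    idealOfSet (flagπ ⁻¹' (schubertOp (permU i) ∩ schubert (w0 n * permV k))) =
      idealL n i ⊔ idealK n ((k : ℕ) + 1) := by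
  apply le_antisymm
  · intro f hf
    rw [mem_idealOfSet_iff] at hf
    have hprime := idealL_sup_idealK_isPrime (n := n) i (k := (k : ℕ) + 1) k.isLt
      (Nat.succ_ne_zero _)
    refine (hprime.mem_or_mem (x := f) (y := (genericZ n).det) ?_).resolve_right
      (det_notMem_idealL_sup_idealK k.isLt le_rfl (Nat.lt_succ_of_le hik))
    rw [mem_idealL_sup_idealK_iff k.isLt]
    intro M hL hK
    rw [map_mul, evalMat_det_genericZ]
    by_cases h0 : M.det = 0
    · rw [h0, mul_zero]
    have h1 := hf (Matrix.GeneralLinearGroup.mkOfDetNeZero M h0)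
      ⟨(flagπ_mem_schubertOp_iff i _).mpr fun f hf => mem_idealL_iff.mp hf M hL,
        (flagπ_mem_schubert_iff k _).mpr fun f hf => (mem_idealK_iff k.isLt).mp hf M hK⟩
    have h2 : evalMat M f = 0 := h1
    rw [h2, zero_mul]
  · refine sup_le (fun f hf => mem_idealOfSet_iff.mpr ?_) (fun f hf => mem_idealOfSet_iff.mpr ?_)
    · rintro g ⟨hg, -⟩
      exact (flagπ_mem_schubertOp_iff i g).mp hg f hf
    · rintro g ⟨-, hg⟩
      exact (flagπ_mem_schubert_iff k g).mp hg f hf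

end Schubert

section Hessenberg

open MvPolynomial

/-! ### The Hessenberg ideal as a sum of products -/

variable {n : ℕ}

theorem hessMatrix_inr (x : Matrix (Fin n) (Fin n) ℂ) (h : Fin n → Fin n) (i a : Fin n)
    (j : {j : Fin n // j ≤ h i}) :
    hessMatrix x h i a (Sum.inr j) = genericZ n a j := rfl

theorem exists_corner_le {h : Fin n → Fin n} (hh : IsHessenberg h) :
    ∀ i : Fin n, ∃ c ∈ corners h, c ≤ i ∧ h c = h i := by
  intro i
  obtain ⟨m, hm⟩ : ∃ m, (i : ℕ) = m := ⟨_, rfl⟩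
  induction m generalizing i with
  | zero => exact ⟨i, fun j hj => by omega, le_rfl, rfl⟩
  | succ m ih =>
    by_cases hi : i ∈ corners h
    · exact ⟨i, hi, le_rfl, rfl⟩
    · obtain ⟨j, hj, hlt⟩ : ∃ j : Fin n, (j : ℕ) + 1 = i ∧ ¬ h j < h i := by
        simpa [corners] using hi
      have hji : j ≤ i := by rw [Fin.le_def]; omega
      obtain ⟨c, hc, hcj, hhc⟩ := ih j (by omega)
      exact ⟨c, hc, hcj.trans hji, hhc.trans (le_antisymm (hh.1 hji) (not_lt.mp hlt))⟩

variable [NeZero n]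

/-- The substitution of zero for the first `k` variables of the first row. -/
noncomputable def killFirstRow (n : ℕ) [NeZero n] (k : ℕ) : CoordRing n →ₐ[ℂ] CoordRing n :=
  aeval fun p => if p.1 = 0 ∧ (p.2 : ℕ) < k then 0 else X p

theorem killFirstRow_eq_zero {k : ℕ} {f : CoordRing n} (hf : f ∈ idealL n k) :
    killFirstRow n k f = 0 := by
  have h : idealL n k ≤ RingHom.ker (killFirstRow n k) := by
    refine Ideal.span_le.mpr ?_
    rintro g ⟨j, hj, rfl⟩
    simp [killFirstRow, genericZ_apply, RingHom.mem_ker, hj]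
  exact h hf

theorem sub_killFirstRow_mem (k : ℕ) (f : CoordRing n) : f - killFirstRow n k f ∈ idealL n k := by
  rw [← Ideal.Quotient.eq_zero_iff_mem, map_sub, sub_eq_zero]
  have : (Ideal.Quotient.mkₐ ℂ (idealL n k)) =
      (Ideal.Quotient.mkₐ ℂ (idealL n k)).comp (killFirstRow n k) := by
    ext p
    simp only [killFirstRow, AlgHom.comp_apply, aeval_X]
    split_ifs with hp
    · rw [map_zero]
      refine Ideal.Quotient.eq_zero_iff_mem.mpr (Ideal.subset_span ⟨p.2, hp.2, ?_⟩)
      rw [genericZ_apply, ← hp.1]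
    · rfl
  exact congrArg (fun φ => φ f) this

theorem killFirstRow_minorB (k : ℕ) {l : ℕ} (B : Finset (Fin n)) (hB : B.card = l) (h0 : 0 ∉ B) :
    killFirstRow n k (minorB B hB) = minorB B hB := by
  rw [minorB, AlgHom.map_det]
  congr 1
  ext a b : 2
  have : B.orderEmbOfFin hB a ≠ 0 := fun h => h0 (h ▸ B.orderEmbOfFin_mem hB a)
  simp [killFirstRow, genericZ_apply, this]

/-- The ideals `L_k` and `K_l` are generated in disjoint sets of variables, so that their
intersection is their product. -/
theorem idealL_inf_idealK_le (k l : ℕ) : idealL n k ⊓ idealK n l ≤ idealL n k * idealK n l := by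
  have key : ∀ f ∈ idealK n l, f - killFirstRow n k f ∈ idealL n k * idealK n l ∧
      killFirstRow n k f ∈ idealK n l := by
    intro f hf
    refine Submodule.span_induction ?_ (by simp) ?_ ?_ hf
    · rintro f ⟨B, hB, h0, rfl⟩
      rw [killFirstRow_minorB k B hB h0, sub_self]
      exact ⟨Ideal.zero_mem _, Ideal.subset_span ⟨B, hB, h0, rfl⟩⟩
    · rintro f g _ _ ⟨hf, hf'⟩ ⟨hg, hg'⟩
      rw [map_add, add_sub_add_comm]
      exact ⟨Ideal.add_mem _ hf hg, Ideal.add_mem _ hf' hg'⟩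
    · rintro a f _ ⟨hf, hf'⟩
      rw [smul_eq_mul, map_mul]
      refine ⟨?_, Ideal.mul_mem_left _ _ hf'⟩
      have : a * f - killFirstRow n k a * killFirstRow n k f =
          a * (f - killFirstRow n k f) + (a - killFirstRow n k a) * killFirstRow n k f := by ring
      rw [this]
      exact Ideal.add_mem _ (Ideal.mul_mem_left _ _ hf)
        (Ideal.mul_mem_mul (sub_killFirstRow_mem k a) hf')
  rintro f ⟨hL, hK⟩
  have := (key f hK).1
  rwa [killFirstRow_eq_zero hL, sub_zero] at this

theorem hessMatrix_inl (h : Fin n → Fin n) (i a : Fin n) (j : {j : Fin n // j ≤ i}) :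
    hessMatrix (diagS n) h i a (Sum.inl j) = if a = 0 then genericZ n 0 j else 0 := by
  have : (diagS n).map (algebraMap ℂ (CoordRing n)) =
      Matrix.diagonal fun i => if i = 0 then 1 else 0 := by
    rw [diagS, Matrix.diagonal_map (map_zero _)]
    congr 1
    funext i
    split_ifs <;> simp
  simp only [hessMatrix, Matrix.of_apply, Sum.elim_inl, this, Matrix.diagonal_mul]
  split_ifs with ha
  · rw [one_mul, ha]
  · rw [zero_mul]

/-- If the lower parts of `v₁, …, v_{h(i)}` are dependent, then `v₁, …, v_{h(i)}, e₁` span a space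
of dimension at most `h(i)`. -/
theorem rank_hessMatrix_le (h : Fin n → Fin n) (i : Fin n) {M : Matrix (Fin n) (Fin n) ℂ}
    (hM : LowerDependent ((h i : ℕ) + 1) M) :
    ((hessMatrix (diagS n) h i).map (evalMat M)).rank ≤ (h i : ℕ) + 1 := by
  classical
  obtain ⟨w, hw, hws, hker⟩ := hM
  obtain ⟨q₀, hq₀⟩ := Function.ne_iff.mp hw
  have hq₀h : q₀ ≤ h i := by
    by_contra! hlt
    exact hq₀ (hws q₀ hlt)
  -- the column `q₀` is a combination of `e₁` and the other columns
  let S : {q : Fin n // q ≤ h i} → (Fin n → ℂ) := fun q =>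
    if q.1 = q₀ then Pi.single 0 1 else M.col q.1
  let W := Submodule.span ℂ (Set.range S)
  have he : Pi.single 0 1 ∈ W := Submodule.subset_span ⟨⟨q₀, hq₀h⟩, by simp [S]⟩
  have hv : ∀ q : Fin n, q ≤ h i → q ≠ q₀ → M.col q ∈ W := fun q hq hne =>
    Submodule.subset_span ⟨⟨q, hq⟩, by simp [S, hne]⟩
  have hMw : M.mulVec w ∈ W := by
    have : M.mulVec w = (M.mulVec w 0) • Pi.single (M := fun _ => ℂ) (0 : Fin n) 1 := by
      funext a
      by_cases ha : a = 0
      · subst ha; simp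
      · simp [ha, hker a ha]
    rw [this]
    exact W.smul_mem _ he
  have hv₀ : M.col q₀ ∈ W := by
    have h1 : M.mulVec w = w q₀ • M.col q₀ + ∑ q ∈ Finset.univ.erase q₀, w q • M.col q := by
      rw [Finset.add_sum_erase _ (fun q => w q • M.col q) (Finset.mem_univ q₀)]
      funext a
      simp [Matrix.mulVec, dotProduct, mul_comm]
    have h2 : w q₀ • M.col q₀ ∈ W := by
      rw [eq_sub_of_add_eq h1.symm]
      refine W.sub_mem hMw (W.sum_mem fun q hq => ?_)
      by_cases hqh : q ≤ h i
      · exact W.smul_mem _ (hv q hqh (Finset.mem_erase.mp hq).1)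
      · rw [hws q (not_le.mp hqh), zero_smul]
        exact W.zero_mem
    have h3 := W.smul_mem (w q₀)⁻¹ h2
    rwa [smul_smul, inv_mul_cancel₀ hq₀, one_smul] at h3
  have hcols : Submodule.span ℂ
      (Set.range ((hessMatrix (diagS n) h i).map (evalMat M)).col) ≤ W := by
    refine Submodule.span_le.mpr ?_
    rintro _ ⟨c, rfl⟩
    rcases c with j | q
    · have : ((hessMatrix (diagS n) h i).map (evalMat M)).col (Sum.inl j) =
          M 0 j • Pi.single (M := fun _ => ℂ) (0 : Fin n) 1 := by
        funext a
        by_cases ha : a = 0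
        · subst ha
          simp [Matrix.col_apply, hessMatrix_inl, genericZ_apply, evalMat]
        · simp [Matrix.col_apply, hessMatrix_inl, ha]
      rw [this]
      exact W.smul_mem _ he
    · have : ((hessMatrix (diagS n) h i).map (evalMat M)).col (Sum.inr q) = M.col q := by
        funext a
        simp [Matrix.col_apply, hessMatrix_inr, genericZ_apply, evalMat]
      rw [this]
      by_cases hq : q.1 = q₀
      · rw [hq]; exact hv₀
      · exact hv q q.2 hq
  rw [Matrix.rank_eq_finrank_span_cols]
  calc Module.finrank ℂ (Submodule.span ℂ
        (Set.range ((hessMatrix (diagS n) h i).map (evalMat M)).col))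
      ≤ Module.finrank ℂ W := Submodule.finrank_mono hcols
    _ ≤ Fintype.card {q : Fin n // q ≤ h i} := finrank_range_le_card S
    _ = (h i : ℕ) + 1 := by
      rw [Fintype.card_subtype]
      have : (Finset.univ.filter fun q : Fin n => q ≤ h i) = Finset.Iic (h i) := by
        ext; simp
      rw [this, Fin.card_Iic]

/-- The summand of the Hessenberg ideal at `i` is the product `L_i K_{h(i)}`, since `s v_j` is
`z_{1j}` times the first basis vector. -/
theorem hessIdealAt_diagS (h : Fin n → Fin n) (i : Fin n) :
    hessIdealAt (diagS n) h i = idealL n ((i : ℕ) + 1) * idealK n ((h i : ℕ) + 1) := by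
  apply le_antisymm
  · refine le_trans (Ideal.span_le.mpr ?_) (idealL_inf_idealK_le _ _)
    rintro f ⟨r, c, rfl⟩
    refine ⟨?_, ?_⟩
    · -- there are too few columns `v_q` to avoid the columns `s v_j`
      obtain ⟨b, j, hb⟩ : ∃ b j, c b = Sum.inl j := by
        by_contra! hcon
        have hr : ∀ b, ∃ q, c b = Sum.inr q := fun b => by
          rcases hcb : c b with j | q
          · exact absurd hcb (hcon b j)
          · exact ⟨q, rfl⟩
        choose d hd using hr
        have hinj : Function.Injective fun b => (d b).1 := fun a b hab => by
          have h1 : d a = d b := Subtype.ext hab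
          exact c.injective (by rw [hd, hd, h1])
        have hcard := Finset.card_le_card_of_injOn (s := Finset.univ) (t := Finset.Iic (h i))
          (fun b => (d b).1) (fun b _ => by simpa using (d b).2) hinj.injOn
        rw [Finset.card_univ, Fintype.card_fin, Fin.card_Iic] at hcard
        omega
      rw [SetLike.mem_coe, mem_idealL_iff]
      intro M hM
      rw [AlgHom.map_det]
      refine Matrix.det_eq_zero_of_column_eq_zero b fun a => ?_
      have hj : M 0 j = 0 := hM j (Nat.lt_succ_of_le j.2)
      simp only [AlgHom.mapMatrix_apply, Matrix.map_apply, Matrix.submatrix_apply, hb,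
        hessMatrix_inl]
      split_ifs
      · simpa [genericZ_apply, evalMat] using hj
      · simp
    · rw [SetLike.mem_coe, mem_idealK_iff (h i).isLt]
      intro M hM
      rw [AlgHom.map_det]
      by_contra hdet
      have h1 := Matrix.rank_of_isUnit _
        ((Matrix.isUnit_iff_isUnit_det _).mpr (isUnit_iff_ne_zero.mpr hdet))
      have h2 := (Matrix.rank_submatrix_le ((hessMatrix (diagS n) h i).map (evalMat M)) r c).trans
        (rank_hessMatrix_le h i hM)
      have h3 : (evalMat M).mapMatrix ((hessMatrix (diagS n) h i).submatrix r c) =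
          ((hessMatrix (diagS n) h i).map (evalMat M)).submatrix r c := rfl
      rw [h3] at h1
      rw [h1, Fintype.card_fin] at h2
      omega
  · rw [idealL, idealK, Ideal.span_mul_span']
    refine Ideal.span_le.mpr ?_
    rintro _ ⟨_, ⟨j, hj, rfl⟩, _, ⟨B, hB, h0, rfl⟩, rfl⟩
    let r : Fin ((h i : ℕ) + 2) → Fin n := Fin.cons 0 (B.orderEmbOfFin hB)
    let c : Fin ((h i : ℕ) + 2) → {j : Fin n // j ≤ i} ⊕ {j : Fin n // j ≤ h i} :=
      Fin.cons (Sum.inl ⟨j, Nat.lt_succ_iff.mp hj⟩)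
        fun b => Sum.inr ⟨Fin.castLE (h i).isLt b, Nat.lt_succ_iff.mp b.isLt⟩
    have hr : Function.Injective r := by
      rw [Fin.cons_injective_iff]
      refine ⟨?_, (B.orderEmbOfFin hB).injective⟩
      rintro ⟨a, ha⟩
      exact h0 (ha ▸ B.orderEmbOfFin_mem hB a)
    have hc : Function.Injective c := by
      rw [Fin.cons_injective_iff]
      refine ⟨?_, fun a b hab => ?_⟩
      · rintro ⟨a, ha⟩
        simp at ha
      · simpa [Fin.ext_iff] using hab
    refine Ideal.subset_span ⟨⟨r, hr⟩, ⟨c, hc⟩, ?_⟩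
    rw [Matrix.det_succ_column_zero, Finset.sum_eq_single 0]
    · simp only [Matrix.submatrix_apply, Function.Embedding.coeFn_mk]
      have h1 : hessMatrix (diagS n) h i (r 0) (c 0) = genericZ n 0 j := by
        simp [r, c, hessMatrix_inl]
      rw [h1]
      simp only [Fin.val_zero, pow_zero, one_mul]
      congr 1
    · intro a _ ha
      obtain ⟨a, rfl⟩ := Fin.exists_succ_eq.mpr ha
      have h1 : r a.succ ≠ 0 := by
        simp only [r, Fin.cons_succ]
        exact fun h => h0 (h ▸ B.orderEmbOfFin_mem hB a)
      have h2 : hessMatrix (diagS n) h i (r a.succ) (c 0) = 0 := by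
        simp only [c, Fin.cons_zero, hessMatrix_inl, if_neg h1]
      simp only [Matrix.submatrix_apply, Function.Embedding.coeFn_mk, h2, mul_zero, zero_mul]
    · simp

/-! ### The Hessenberg ideal as an intersection of primes -/

/-- Both the sum of the products `L_i K_{h(i)}` and the intersection of the `L_{i-1} + K_{h(i)}`
consist of the polynomials for which the coefficient of each monomial in the first-row variables,
with first variable `z_{1p}`, lies in `K_{h(p)}`, and the coefficient of `1` vanishes. The
induction treats one variable at a time. -/
theorem hessIdeal_diagS {h : Fin n → Fin n} (hh : IsHessenberg h) :
    hessIdeal (diagS n) h = ⨅ i ∈ corners h, cornerIdeal h i := by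
  have hn : 0 < n := Nat.pos_of_ne_zero (NeZero.ne n)
  simp only [hessIdeal, hessIdealAt_diagS]
  apply le_antisymm
  · refine iSup_le fun i => le_iInf₂ fun c _ => ?_
    rcases lt_or_ge i c with hic | hci
    · have h1 : idealL n ((i : ℕ) + 1) ≤ idealL n c := idealL_mono hic
      exact (Ideal.mul_le_left.trans h1).trans le_sup_left
    · have h1 : idealK n ((h i : ℕ) + 1) ≤ idealK n ((h c : ℕ) + 1) :=
        idealK_anti (Nat.succ_le_succ (hh.1 hci)) (h i).isLt
      exact (Ideal.mul_le_right.trans h1).trans le_sup_right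
  · intro f hf
    have hall : ∀ i, f ∈ cornerIdeal h i := by
      intro i
      obtain ⟨c, hc, hci, hhc⟩ := exists_corner_le hh i
      have h1 : f ∈ cornerIdeal h c := (Ideal.mem_iInf.mp (Ideal.mem_iInf.mp hf c)) hc
      rw [cornerIdeal, hhc] at h1
      exact sup_le_sup_right (idealL_mono (show (c : ℕ) ≤ i from hci)) _ h1
    let S : ℕ → Ideal (CoordRing n) := fun t => ⨆ i : Fin n, ⨆ _ : (i : ℕ) < t,
      idealL n ((i : ℕ) + 1) * idealK n ((h i : ℕ) + 1)
    have hS : ∀ t, S t ≤ idealL n t := fun t => iSup₂_le fun i hi =>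
      Ideal.mul_le_left.trans (idealL_mono hi)
    have hS_mono : ∀ t, S t ≤ S (t + 1) := fun t => iSup₂_le fun i hi =>
      le_iSup₂_of_le i (hi.trans (Nat.lt_succ_self t)) le_rfl
    have key : ∀ t (ht : t < n), f ∈ S t ⊔ idealK n ((h ⟨t, ht⟩ : ℕ) + 1) := by
      intro t
      induction t with
      | zero =>
        intro ht
        have := hall ⟨0, ht⟩
        rw [cornerIdeal, idealL_zero, bot_sup_eq] at this
        exact Ideal.mem_sup_right this
      | succ t ih =>
        intro ht
        have htn : t < n := (Nat.lt_succ_self t).trans ht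
        have hKK : idealK n ((h ⟨t + 1, ht⟩ : ℕ) + 1) ≤ idealK n ((h ⟨t, htn⟩ : ℕ) + 1) :=
          idealK_anti (Nat.succ_le_succ (hh.1 (Fin.mk_le_mk.mpr (Nat.le_succ t))))
            (h _).isLt
        obtain ⟨g, hg, k, hk, hgk⟩ := Submodule.mem_sup.mp (ih htn)
        have hk2 : k ∈ idealL n (t + 1) ⊔ idealK n ((h ⟨t + 1, ht⟩ : ℕ) + 1) := by
          have h1 := Ideal.sub_mem _ (hall ⟨t + 1, ht⟩)
            (Ideal.mem_sup_left (idealL_mono (Nat.le_succ t) (hS t hg)))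
          rwa [← hgk, add_sub_cancel_left] at h1
        obtain ⟨l, hl, k', hk', hlk⟩ := Submodule.mem_sup.mp hk2
        have hl2 : l ∈ S (t + 1) := by
          have h1 : l ∈ idealK n ((h ⟨t, htn⟩ : ℕ) + 1) := by
            have := Ideal.sub_mem _ hk (hKK hk')
            rwa [← hlk, add_sub_cancel_right] at this
          have h2 := idealL_inf_idealK_le _ _ (Submodule.mem_inf.mpr ⟨hl, h1⟩)
          exact le_iSup₂_of_le (f := fun (i : Fin n) (_ : (i : ℕ) < t + 1) =>
            idealL n ((i : ℕ) + 1) * idealK n ((h i : ℕ) + 1)) ⟨t, htn⟩ (Nat.lt_succ_self t) le_rfl h2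
        rw [← hgk, ← hlk, ← add_assoc]
        exact Ideal.add_mem _ (Ideal.mem_sup_left (Ideal.add_mem _ (hS_mono t hg) hl2))
          (Ideal.mem_sup_right hk')
    -- at the last step `K_n = 0`
    have hlast := key (n - 1) (by omega)
    have hval : (h ⟨n - 1, by omega⟩ : ℕ) + 1 = n := by
      have h1 : n - 1 ≤ (h ⟨n - 1, by omega⟩ : ℕ) := hh.2 ⟨n - 1, by omega⟩
      have h2 := (h ⟨n - 1, by omega⟩).isLt
      omega
    rw [hval, idealK_self, sup_bot_eq] at hlast
    exact (iSup₂_le fun i _ => le_iSup (fun i : Fin n =>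
      idealL n ((i : ℕ) + 1) * idealK n ((h i : ℕ) + 1)) i) hlast

theorem le_saturate {m : ℕ} (I : Ideal (CoordRing m)) : I ≤ saturate I := Ideal.le_comap_map

/-- None of the primes `L_{i-1} + K_{h(i)}` contains the determinant. -/
theorem saturate_hessIdeal {h : Fin n → Fin n} (hh : IsHessenberg h) :
    saturate (hessIdeal (diagS n) h) = hessIdeal (diagS n) h := by
  refine le_antisymm ?_ (le_saturate _)
  conv_rhs => rw [hessIdeal_diagS hh]
  refine le_iInf₂ fun i hi => ?_
  have hprime := cornerIdeal_isPrime h i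
  have h1 : hessIdeal (diagS n) h ≤ cornerIdeal h i := by
    rw [hessIdeal_diagS hh]
    exact iInf₂_le i hi
  have h2 : saturate (cornerIdeal h i) = cornerIdeal h i := by
    refine IsLocalization.under_map_of_isPrime_disjoint (Submonoid.powers (genericZ n).det) _
      hprime ?_
    rw [Set.disjoint_left]
    rintro _ ⟨k, rfl⟩ hk
    exact det_notMem_cornerIdeal hh i (hprime.mem_of_pow_mem k hk)
  exact (Ideal.comap_mono (Ideal.map_mono h1)).trans h2.le

end Hessenberg

/-! ### Irredundant finite intersections of primes -/

section Primes

variable {ι R : Type*} [CommRing R] {s : Set ι} {P : ι → Ideal R}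

theorem minimalPrimes_biInf (hs : s.Finite) (hP : ∀ i ∈ s, (P i).IsPrime)
    (hinc : ∀ i ∈ s, ∀ j ∈ s, P i ≤ P j → i = j) :
    (⨅ i ∈ s, P i).minimalPrimes = P '' s := by
  have hmem : ∀ p : Ideal R, p.IsPrime → ⨅ i ∈ s, P i ≤ p → ∃ i ∈ s, P i ≤ p := by
    intro p hp hle
    have h1 : hs.toFinset.inf P ≤ p := by
      rw [Finset.inf_eq_iInf]
      simpa using hle
    obtain ⟨i, hi, h⟩ := (Ideal.IsPrime.inf_le' hp).mp h1
    exact ⟨i, by simpa using hi, h⟩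
  ext p
  constructor
  · intro hp
    obtain ⟨i, hi, hle⟩ := hmem p hp.1.1 hp.1.2
    exact ⟨i, hi, le_antisymm hle (hp.2 ⟨hP i hi, iInf₂_le i hi⟩ hle)⟩
  · rintro ⟨i, hi, rfl⟩
    refine ⟨⟨hP i hi, iInf₂_le i hi⟩, fun q hq hqi => ?_⟩
    obtain ⟨j, hj, hle⟩ := hmem q hq.1 hq.2
    have := hinc j hj i hi (hle.trans hqi)
    exact this ▸ hle

theorem associatedPrimes_quotient_biInf (hs : s.Finite) (hP : ∀ i ∈ s, (P i).IsPrime)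
    (hinc : ∀ i ∈ s, ∀ j ∈ s, P i ≤ P j → i = j) :
    associatedPrimes R (R ⧸ ⨅ i ∈ s, P i) = P '' s := by
  classical
  set J := ⨅ i ∈ s, P i with hJ
  have hdec : Submodule.IsMinimalPrimaryDecomposition J (hs.toFinset.image P) := by
    refine ⟨?_, ?_, ?_, ?_⟩
    · rw [Finset.inf_image, Finset.inf_eq_iInf]
      simp [hJ]
    · intro q hq
      obtain ⟨i, hi, rfl⟩ := Finset.mem_image.mp hq
      exact (hP i (by simpa using hi)).isPrimary
    · intro q hq q' hq' hne
      obtain ⟨i, hi, rfl⟩ := Finset.mem_image.mp hq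
      obtain ⟨j, hj, rfl⟩ := Finset.mem_image.mp hq'
      simpa [Function.onFun, Submodule.colon_univ, (hP i (by simpa using hi)).radical,
        (hP j (by simpa using hj)).radical] using hne
    · intro q hq hle
      obtain ⟨i, hi, rfl⟩ := Finset.mem_image.mp hq
      have hprime := hP i (by simpa using hi)
      obtain ⟨q', hq', hle'⟩ := (Ideal.IsPrime.inf_le' hprime).mp hle
      obtain ⟨hne, hq'⟩ := Finset.mem_erase.mp hq'
      obtain ⟨j, hj, rfl⟩ := Finset.mem_image.mp hq'
      exact hne (congrArg P (hinc j (by simpa using hj) i (by simpa using hi) hle'))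
  have h1 := hdec.image_radical_eq_associated_primes
  have h2 : (fun q : Ideal R => (Submodule.colon q Set.univ).radical) '' (hs.toFinset.image P) =
      P '' s := by
    rw [Finset.coe_image, Set.image_image, Set.Finite.coe_toFinset]
    refine Set.image_congr fun i hi => ?_
    rw [Submodule.colon_univ, (hP i hi).radical]
  rw [← h2, h1]
  have h3 : ∀ x : R, Submodule.colon (⊥ : Submodule R (R ⧸ J)) {Ideal.Quotient.mk J x} =
      Submodule.colon J {x} := by
    intro x
    ext r
    rw [Submodule.mem_colon_singleton, Submodule.mem_colon_singleton, Submodule.mem_bot,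
      ← Ideal.Quotient.eq_zero_iff_mem]
    rfl
  ext p
  constructor
  · rintro ⟨hp, x, hx⟩
    obtain ⟨x, rfl⟩ := Ideal.Quotient.mk_surjective x
    exact ⟨hp, x, by rw [hx, h3]⟩
  · rintro ⟨hp, x, hx⟩
    exact ⟨hp, Ideal.Quotient.mk J x, by rw [hx, h3]⟩

/-- The irreducible components of `Spec (R / J)` are cut out by the minimal primes over `J`. -/
theorem bijOn_irreducibleComponents {J : Ideal R} (hmin : J.minimalPrimes = P '' s)
    (hinj : Set.InjOn P s) :
    Set.BijOn (fun i => PrimeSpectrum.comap (Ideal.Quotient.mk J) ⁻¹'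
      PrimeSpectrum.zeroLocus (P i : Set R)) s (irreducibleComponents (PrimeSpectrum (R ⧸ J))) := by
  have hcomap : ∀ q : Ideal (R ⧸ J), PrimeSpectrum.comap (Ideal.Quotient.mk J) ⁻¹'
      PrimeSpectrum.zeroLocus (q.comap (Ideal.Quotient.mk J) : Set R) =
        PrimeSpectrum.zeroLocus (q : Set (R ⧸ J)) := by
    intro q
    rw [PrimeSpectrum.preimage_comap_zeroLocus, Ideal.coe_comap,
      Set.image_preimage_eq _ Ideal.Quotient.mk_surjective]
  rw [Ideal.minimalPrimes_eq_comap] at hmin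
  rw [← PrimeSpectrum.zeroLocus_minimalPrimes]
  refine ⟨fun i hi => ?_, fun i hi j hj hij => hinj hi hj ?_, ?_⟩
  · obtain ⟨q, hq, hqi⟩ : P i ∈ Ideal.comap (Ideal.Quotient.mk J) '' minimalPrimes (R ⧸ J) := by
      rw [hmin]; exact ⟨i, hi, rfl⟩
    refine ⟨q, hq, ?_⟩
    simp only [Function.comp_apply]
    rw [← hqi, hcomap]
  · obtain ⟨q, hq, hqi⟩ : P i ∈ Ideal.comap (Ideal.Quotient.mk J) '' minimalPrimes (R ⧸ J) := by
      rw [hmin]; exact ⟨i, hi, rfl⟩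
    obtain ⟨q', hq', hqj⟩ : P j ∈ Ideal.comap (Ideal.Quotient.mk J) '' minimalPrimes (R ⧸ J) := by
      rw [hmin]; exact ⟨j, hj, rfl⟩
    simp only at hij
    rw [← hqi, ← hqj, hcomap, hcomap, PrimeSpectrum.zeroLocus_eq_iff, hq.1.1.radical,
      hq'.1.1.radical] at hij
    rw [← hqi, ← hqj, hij]
  · rintro _ ⟨q, hq, rfl⟩
    obtain ⟨i, hi, hqi⟩ : q.comap (Ideal.Quotient.mk J) ∈ P '' s := by
      rw [← hmin]; exact ⟨q, hq, rfl⟩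
    refine ⟨i, hi, ?_⟩
    simp only [Function.comp_apply]
    rw [hqi, hcomap]

end Primes

/-! ### Closed subschemes of the scheme of matrices -/

section Schemes

variable {n : ℕ}

/-- Ideals of the coordinate ring correspond to ideal sheaves on the affine scheme of matrices. -/
noncomputable def closedSubOrderIso (n : ℕ) :
    Ideal (CoordRing n) ≃o (MatScheme n).IdealSheafData :=
  (Scheme.ΓSpecIso
    (CommRingCat.of (CoordRing n))).commRingCatIsoToRingEquiv.idealComapOrderIso.trans
    (Scheme.IdealSheafData.equivOfIsAffine (X := MatScheme n)).toOrderIso.symm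

theorem closedSubOrderIso_apply (I : Ideal (CoordRing n)) :
    closedSubOrderIso n I = closedSub I := by
  rw [closedSub, Scheme.ker_of_isAffine]
  change Scheme.IdealSheafData.ofIdealTop _ = _
  congr 1
  ext x
  rw [RingHom.mem_ker]
  have h1 := Scheme.ΓSpecIso_naturality (CommRingCat.ofHom (Ideal.Quotient.mk I))
  have h2 := congrArg (fun φ => φ.hom x) h1
  have hinj : Function.Injective
      (Scheme.ΓSpecIso (CommRingCat.of (CoordRing n ⧸ I))).hom.hom :=
    (Scheme.ΓSpecIso (CommRingCat.of (CoordRing n ⧸ I))).commRingCatIsoToRingEquiv.injective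
  change (Scheme.ΓSpecIso (CommRingCat.of (CoordRing n))).hom.hom x ∈ I ↔ _
  rw [← Ideal.Quotient.eq_zero_iff_mem, ← map_eq_zero_iff _ hinj]
  exact Eq.congr h2.symm rfl

theorem closedSub_sup (I J : Ideal (CoordRing n)) :
    closedSub (I ⊔ J) = closedSub I ⊔ closedSub J := by
  simp only [← closedSubOrderIso_apply, map_sup]

theorem closedSub_biInf {ι : Type*} (s : Set ι) (I : ι → Ideal (CoordRing n)) :
    closedSub (⨅ i ∈ s, I i) = ⨅ i ∈ s, closedSub (I i) := by
  simp only [← closedSubOrderIso_apply, map_iInf]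

theorem coe_support_closedSub (I : Ideal (CoordRing n)) :
    ((closedSub I).support : Set (MatScheme n)) =
      PrimeSpectrum.zeroLocus (I : Set (CoordRing n)) := by
  rw [closedSub, Scheme.Hom.support_ker]
  have h : Set.range (subSchemeι I) = PrimeSpectrum.zeroLocus (I : Set (CoordRing n)) := by
    have := range_comap_of_surjective _ (Ideal.Quotient.mk I)
      Ideal.Quotient.mk_surjective
    rw [Ideal.mk_ker] at this
    exact this
  rw [h]
  exact (PrimeSpectrum.isClosed_zeroLocus _).closure_eq

end Schemes

end MatHess

open MatHess

theorem theorem3 (n : ℕ) [NeZero n] (h : Fin n → Fin n) (hh : IsHessenberg h) :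
    -- the matrix Hessenberg scheme is reduced
    AlgebraicGeometry.IsReduced (hessScheme (diagS n) h) ∧
    -- as a closed subscheme it is the union of the intersections of matrix Schubert varieties
    (subSchemeι (saturate (hessIdeal (diagS n) h))).ker =
      (⨅ i ∈ corners h, (matSchubertOp (permU i) ⊔ matSchubert (w0 n * permV (h i)))) ∧
    -- each of these intersections is a matrix Richardson variety, with ideal `L_{i-1} + K_{h(i)}`
    (∀ i ∈ corners h,
      (schubertOp (permU i) ∩ schubert (w0 n * permV (h i))).Nonempty ∧
      matSchubertOp (permU i) ⊔ matSchubert (w0 n * permV (h i)) =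
        matRichardson (permU i) (w0 n * permV (h i)) ∧
      matSchubertOp (permU i) ⊔ matSchubert (w0 n * permV (h i)) =
        closedSub (cornerIdeal h i)) ∧
    -- the ideals
    saturate (hessIdeal (diagS n) h) = hessIdeal (diagS n) h ∧
    hessIdeal (diagS n) h = (⨅ i ∈ corners h, cornerIdeal h i) ∧
    -- the associated primes
    (∀ i ∈ corners h, (cornerIdeal h i).IsPrime) ∧
    associatedPrimes (CoordRing n) (CoordRing n ⧸ hessIdeal (diagS n) h) =
      cornerIdeal h '' corners h ∧
    (∀ i ∈ corners h, ∀ j ∈ corners h, cornerIdeal h i ≤ cornerIdeal h j → i = j) ∧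
    -- the irreducible components are in bijection with the corners
    Set.BijOn
      (fun i => subSchemeι (saturate (hessIdeal (diagS n) h)) ⁻¹'
        ((matSchubertOp (permU i) ⊔ matSchubert (w0 n * permV (h i))).support :
          Set (MatScheme n)))
      (corners h) (irreducibleComponents (hessScheme (diagS n) h)) := by
  have hcorner : ∀ i, matSchubertOp (permU i) ⊔ matSchubert (w0 n * permV (h i)) =
      closedSub (cornerIdeal h i) := by
    intro i
    rw [matSchubertOp, matSchubert, idealOfSet_doubleCoset_permU, idealOfSet_doubleCoset_permV,
      ← closedSub_sup]
    rfl
  have hsat := saturate_hessIdeal hh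
  have hint := hessIdeal_diagS hh
  have hprime : ∀ i ∈ corners h, (cornerIdeal h i).IsPrime := fun i _ => cornerIdeal_isPrime h i
  have hinc : ∀ i ∈ corners h, ∀ j ∈ corners h, cornerIdeal h i ≤ cornerIdeal h j → i = j :=
    fun i _ j hj => eq_of_cornerIdeal_le hh hj
  have hfin : (corners h).Finite := Set.toFinite _
  have hrad : (hessIdeal (diagS n) h).IsRadical := by
    rw [hint]
    exact Ideal.isRadical_iInf _ fun i => Ideal.isRadical_iInf _ fun hi => (hprime i hi).isRadical
  refine ⟨?_, ?_, fun i _ => ⟨richardson_nonempty (hh.2 i), ?_, hcorner i⟩, hsat, hint, hprime, ?_,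
    hinc, ?_⟩
  · rw [affine_isReduced_iff, hsat]
    exact (Ideal.isRadical_iff_quotient_reduced _).mp hrad
  · simp only [hcorner]
    rw [← closedSub_biInf, ← hint, hsat]
    rfl
  · rw [hcorner, matRichardson, idealOfSet_richardson (hh.2 i)]
    rfl
  · conv_lhs => rw [hint]
    exact associatedPrimes_quotient_biInf hfin hprime hinc
  · simp only [hcorner, coe_support_closedSub]
    refine bijOn_irreducibleComponents ?_ fun i hi j hj hij => hinc i hi j hj hij.le
    rw [hsat, hint]
    exact minimalPrimes_biInf hfin hprime hinc
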